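/- Let $k$ be a field and let $M$, $H$ be Hopf algebras over $k$ forming a cocycle-free bicrossproduct: $H$ acts on $M$ from the left, $h\otimes m\mapsto h\triangleright m$, making $M$ a left $H$-module algebra; $M$ coacts on $H$ from the right, $\alpha(h)=h^{(1)}\otimes h^{(2)}\in H\otimes M$, making $H$ a right $M$-comodule coalgebra; and $\epsilon(h\triangleright m)=\epsilon(h)\epsilon(m)$, $\Delta(h\triangleright m)=h_1{}^{(1)}\triangleright m_1\otimes h_1{}^{(2)}(h_2\triangleright m_2)$, $\alpha(1)=1\otimes 1$, $\alpha(gh)=g_1{}^{(1)}h^{(1)}\otimes g_1{}^{(2)}(g_2\triangleright h^{(2)})$, $h_2{}^{(1)}\otimes(h_1\triangleright m)h_2{}^{(2)}=h_1{}^{(1)}\otimes h_1{}^{(2)}(h_2\triangleright m)$. Let $P=M\blacktriangleright\!\!\!\triangleleft H$ be the resulting Hopf algebra on $M\otimes H$, with product $(m\otimes h)(n\otimes g)=m(h_1\triangleright n)\otimes h_2g$, coproduct $\Delta(m\otimes h)=m_1\otimes h_1{}^{(1)}\otimes m_2h_1{}^{(2)}\otimes h_2$, unit $1\otimes 1$ and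 counit $\epsilon\otimes\epsilon$. Put $\pi(m\otimes h)=\epsilon(m)h$, $\Delta_R=(\mathrm{id}\otimes\pi)\Delta:P\to P\otimes H$ (whose coinvariants are $M=M\otimes 1$), and $\Phi(h)=1\otimes h$, so that $P$ is a trivial quantum principal $H$-bundle over $M$ with trivialisation $\Phi$ and $\Phi^{-1}=\Phi\circ S$. For an algebra $A$ write $\Omega^1A=\ker(A\otimes A\to A)$ and $d_Ua=1\otimes a-a\otimes 1$; for a Hopf algebra write $\pi_\epsilon(a)=a-\epsilon(a)1$, $\mathrm{Ad}(a)=a_2\otimes S(a_1)a_3$, $\Delta_L(u\otimes v)=u_1v_1\otimes u_2\otimes v_2$, and call a linear map $f$ into $\Omega^1A$ left-invariant if $\Delta_L(f(x))=1\otimes f(x)$ for all $x$. A connection on $P$ is a linear map $\omega_U:\ker\epsilon_H\to\Omega^1P$ with $\chi\circ\omega_U=1\otimes\mathrm{id}$, where $\chi(u\otimes v)=u\Delta_R(v)$, and $\Delta_R\circ\omega_U=(\omega_U\otimes\mathrm{id})\circ\mathrm{Ad}$, where $\Delta_R$ is extended to $P\otimes P$ as the tensor product coaction. It is strong if $(\mathrm{id}-\Pi)(d_UP)\subseteq(\Omega^1M)P$,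 where $\Pi=\cdot\,(\mathrm{id}\otimes\omega_U)\chi$ on $\Omega^1P$. (1) The assignment $$\omega_U(h)=\Phi^{-1}(h_1)\,\beta_U(\pi_\epsilon(h_2))\,\Phi(h_3)+\Phi^{-1}(h_1)\,d_U\Phi(h_2)$$ is a bijection from the set of left-invariant linear maps $\beta_U:\ker\epsilon_H\to\Omega^1M$ such that, for all $h\in H$, $$\beta_U(\pi_\epsilon(h_1))h_2{}^{(2)}\otimes h_2{}^{(1)}-h_1{}^{(2)}\beta_U(\pi_\epsilon(h_2))\otimes h_1{}^{(1)}=-\,d_Uh^{(2)}\otimes h^{(1)}$$ onto the set of strong left-invariant connections on $P$. (2) The assignment $\beta_U(h)=S(\gamma(h)_1)\,d_U\gamma(h)_2$, $h\in\ker\epsilon_H$, is a bijection from the set of linear maps $\gamma:H\to M$ with $\gamma(1)=1$, $\epsilon_M\circ\gamma=\epsilon_H$ and $$\gamma(h_1)h_2{}^{(2)}\otimes h_2{}^{(1)}=\gamma(h_2)\otimes h_1\qquad\text{for all }h\in H$$ onto the set of maps $\beta_U$ in (1). (3) For each such $\gamma$, the map $i(h)=\gamma(h_1)\otimes h_2$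 restricts to a linear map $i:\ker\epsilon_H\to\ker\epsilon_P$ with $\pi\circ i=\mathrm{id}$ and $(\mathrm{id}\otimes\pi)\circ\mathrm{Ad}\circ i=(i\otimes\mathrm{id})\circ\mathrm{Ad}$, and the connection $\omega_U$ corresponding to $\gamma$ by (2) and (1) is the canonical connection of this splitting, $\omega_U(h)=S(i(h)_1)\,d_U\,i(h)_2$. -/

import Mathlib

open scoped TensorProduct

noncomputable section

namespace QPB

/-- Convolution of linear maps from a coalgebra to an algebra: `h ↦ f(h₁) g(h₂)`. -/
def conv {k C A : Type*} [CommSemiring k] [AddCommMonoid C] [Module k C] [Coalgebra k C]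
    [Semiring A] [Algebra k A] (f g : C →ₗ[k] A) : C →ₗ[k] A :=
  LinearMap.mul' k A ∘ₗ TensorProduct.map f g ∘ₗ Coalgebra.comul

section conv

variable {k C A B : Type*} [CommSemiring k] [AddCommMonoid C] [Module k C] [Coalgebra k C]
  [Semiring A] [Algebra k A] [Semiring B] [Algebra k B]

theorem conv_apply (f g : C →ₗ[k] A) (c : C) :
    conv f g c = LinearMap.mul' k A (TensorProduct.map f g (Coalgebra.comul c)) := rfl

theorem conv_assoc (f g h : C →ₗ[k] A) : conv (conv f g) h = conv f (conv g h) :=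
  congrArg WithConv.ofConv
    (mul_assoc (WithConv.toConv f) (WithConv.toConv g) (WithConv.toConv h))

theorem algHom_comp_conv (φ : A →ₐ[k] B) (f g : C →ₗ[k] A) :
    φ.toLinearMap ∘ₗ conv f g = conv (φ.toLinearMap ∘ₗ f) (φ.toLinearMap ∘ₗ g) :=
  LinearMap.algHom_comp_convMul_distrib φ (WithConv.toConv f) (WithConv.toConv g)

theorem mulLeft_comp_conv (x : A) (f g : C →ₗ[k] A) :
    LinearMap.mulLeft k x ∘ₗ conv f g = conv (LinearMap.mulLeft k x ∘ₗ f) g := by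
  ext c
  simp only [LinearMap.comp_apply, conv_apply]
  induction Coalgebra.comul (R := k) c with
  | zero => simp
  | tmul a b => simp [mul_assoc]
  | add a b ha hb => simp only [map_add, ha, hb]

theorem mulRight_comp_conv (x : A) (f g : C →ₗ[k] A) :
    LinearMap.mulRight k x ∘ₗ conv f g = conv f (LinearMap.mulRight k x ∘ₗ g) := by
  ext c
  simp only [LinearMap.comp_apply, conv_apply]
  induction Coalgebra.comul (R := k) c with
  | zero => simp
  | tmul a b => simp [mul_assoc]
  | add a b ha hb => simp only [map_add, ha, hb]

theorem conv_mulRight_left (x : A) (f g : C →ₗ[k] A) :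
    conv (LinearMap.mulRight k x ∘ₗ f) g = conv f (LinearMap.mulLeft k x ∘ₗ g) := by
  ext c
  simp only [conv_apply]
  induction Coalgebra.comul (R := k) c with
  | zero => simp
  | tmul a b => simp [mul_assoc]
  | add a b ha hb => simp only [map_add, ha, hb]

end conv

/-- Data of a cocycle-free bicrossproduct `M ▶◁ H`. The Hopf algebra `H` acts on `M` from the left,
making `M` a left `H`-module algebra, and the Hopf algebra `M` coacts on `H` from the right,
`h ↦ h⁽¹⁾ ⊗ h⁽²⁾ ∈ H ⊗ M`, making `H` a right `M`-comodule coalgebra; the last five fields are the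
usual compatibility conditions of a bicrossproduct. -/
structure MatchedPair (k M H : Type*) [Field k] [Ring M] [Ring H] [HopfAlgebra k M]
    [HopfAlgebra k H] where
  /-- the action `h ▷ m` -/
  act : H →ₐ[k] Module.End k M
  /-- the coaction `h ↦ h⁽¹⁾ ⊗ h⁽²⁾` -/
  coact : H →ₗ[k] H ⊗[k] M
  /-- `h ▷ 1 = ε(h) 1` -/
  act_one : ∀ h, act h 1 = algebraMap k M (Coalgebra.counit h)
  /-- `h ▷ (m n) = (h₁ ▷ m) (h₂ ▷ n)` -/
  act_mul : ∀ m n, act.toLinearMap.flip (m * n) =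
    conv (act.toLinearMap.flip m) (act.toLinearMap.flip n)
  /-- `h⁽¹⁾⁽¹⁾ ⊗ h⁽¹⁾⁽²⁾ ⊗ h⁽²⁾ = h⁽¹⁾ ⊗ h⁽²⁾₁ ⊗ h⁽²⁾₂` -/
  coact_coassoc : ∀ h, TensorProduct.assoc k H M M (coact.rTensor M (coact h)) =
    (Coalgebra.comul (R := k) (A := M)).lTensor H (coact h)
  /-- `h⁽¹⁾ ε(h⁽²⁾) = h` -/
  coact_counit : ∀ h, TensorProduct.rid k H
    ((Coalgebra.counit (R := k) (A := M)).lTensor H (coact h)) = h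
  /-- `ε(h⁽¹⁾) h⁽²⁾ = ε(h) 1` -/
  counit_coact : ∀ h, TensorProduct.lid k M
    ((Coalgebra.counit (R := k) (A := H)).rTensor M (coact h)) =
      algebraMap k M (Coalgebra.counit h)
  /-- `h⁽¹⁾₁ ⊗ h⁽¹⁾₂ ⊗ h⁽²⁾ = h₁⁽¹⁾ ⊗ h₂⁽¹⁾ ⊗ h₁⁽²⁾ h₂⁽²⁾` -/
  comul_coact : (Coalgebra.comul (R := k) (A := H)).rTensor M ∘ₗ coact =
    conv
      ((Algebra.TensorProduct.map Algebra.TensorProduct.includeLeft (AlgHom.id k M) :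
        H ⊗[k] M →ₐ[k] (H ⊗[k] H) ⊗[k] M).toLinearMap ∘ₗ coact)
      ((Algebra.TensorProduct.map Algebra.TensorProduct.includeRight (AlgHom.id k M) :
        H ⊗[k] M →ₐ[k] (H ⊗[k] H) ⊗[k] M).toLinearMap ∘ₗ coact)
  /-- `ε(h ▷ m) = ε(h) ε(m)` -/
  counit_act : ∀ h m, Coalgebra.counit (R := k) (act h m) =
    Coalgebra.counit (R := k) h * Coalgebra.counit (R := k) m
  /-- `Δ(h ▷ m) = (h₁⁽¹⁾ ▷ m₁) ⊗ h₁⁽²⁾ (h₂ ▷ m₂)`. The right hand side is `Δ m` transformed by the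
  convolution, in the algebra of endomorphisms of `M ⊗ M`, of
  `h ↦ (m ⊗ n ↦ (h⁽¹⁾ ▷ m) ⊗ h⁽²⁾ n)` and `h ↦ (m ⊗ n ↦ m ⊗ (h ▷ n))`. -/
  comul_act : ∀ h m, Coalgebra.comul (R := k) (act h m) =
    (conv (A := Module.End k (M ⊗[k] M))
      (TensorProduct.homTensorHomMap (RingHom.id k) M M M M ∘ₗ
        TensorProduct.map act.toLinearMap (LinearMap.mul k M) ∘ₗ coact)
      (LinearMap.lTensorHom M ∘ₗ act.toLinearMap) h) (Coalgebra.comul (R := k) m)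
  /-- `1⁽¹⁾ ⊗ 1⁽²⁾ = 1 ⊗ 1` -/
  coact_one : coact 1 = 1
  /-- `(g h)⁽¹⁾ ⊗ (g h)⁽²⁾ = g₁⁽¹⁾ h⁽¹⁾ ⊗ g₁⁽²⁾ (g₂ ▷ h⁽²⁾)` -/
  coact_mul : ∀ h, coact ∘ₗ LinearMap.mulRight k h =
    conv coact ((LinearMap.lTensorHom H ∘ₗ act.toLinearMap).flip (coact h))
  /-- `h₂⁽¹⁾ ⊗ (h₁ ▷ m) h₂⁽²⁾ = h₁⁽¹⁾ ⊗ h₁⁽²⁾ (h₂ ▷ m)` -/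
  act_coact : ∀ m,
    conv ((Algebra.TensorProduct.includeRight : M →ₐ[k] H ⊗[k] M).toLinearMap ∘ₗ
        act.toLinearMap.flip m) coact =
    conv coact ((Algebra.TensorProduct.includeRight : M →ₐ[k] H ⊗[k] M).toLinearMap ∘ₗ
        act.toLinearMap.flip m)

/-- The underlying vector space `M ⊗ H` of the bicrossproduct `M ▶◁ H`. -/
def Bicross {k M H : Type*} [Field k] [Ring M] [Ring H] [HopfAlgebra k M]
    [HopfAlgebra k H] (_D : MatchedPair k M H) : Type _ := M ⊗[k] H

namespace Bicross

variable {k M H : Type*} [Field k] [Ring M] [Ring H] [HopfAlgebra k M] [HopfAlgebra k H]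
  (D : MatchedPair k M H)

instance : AddCommGroup (Bicross D) := inferInstanceAs (AddCommGroup (M ⊗[k] H))

instance : Module k (Bicross D) := inferInstanceAs (Module k (M ⊗[k] H))

/-- The identification of `M ⊗ H` with `M ▶◁ H`. -/
def of : M ⊗[k] H ≃ₗ[k] Bicross D := LinearEquiv.refl k (M ⊗[k] H)

/-- `m ⊗ h` as an element of `M ▶◁ H`. -/
def tm (m : M) (h : H) : Bicross D := of D (m ⊗ₜ[k] h)

variable {D} in
theorem induction {p : Bicross D → Prop} (zero : p 0) (tmul : ∀ m h, p (tm D m h))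
    (add : ∀ x y, p x → p y → p (x + y)) (x : Bicross D) : p x :=
  TensorProduct.induction_on (motive := fun x => p (of D x)) ((of D).symm x) zero tmul add

/-- `h ⊗ n ↦ (h₁ ▷ n) ⊗ h₂` -/
def cross : H ⊗[k] M →ₗ[k] M ⊗[k] H :=
  (TensorProduct.lift D.act.toLinearMap).rTensor H ∘ₗ
    (TensorProduct.rightComm k H H M).toLinearMap ∘ₗ
      (Coalgebra.comul (R := k) (A := H)).rTensor M

/-- The cross product `(m ⊗ h) (n ⊗ g) = m (h₁ ▷ n) ⊗ h₂ g`. -/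
def mulMap : (M ⊗[k] H) ⊗[k] (M ⊗[k] H) →ₗ[k] M ⊗[k] H :=
  TensorProduct.map (LinearMap.mul' k M) (LinearMap.mul' k H) ∘ₗ
    (TensorProduct.assoc k M M (H ⊗[k] H)).symm.toLinearMap ∘ₗ
    ((TensorProduct.assoc k M H H).toLinearMap ∘ₗ (cross D).rTensor H ∘ₗ
      (TensorProduct.assoc k H M H).symm.toLinearMap).lTensor M ∘ₗ
    (TensorProduct.assoc k M H (M ⊗[k] H)).toLinearMap

instance : Mul (Bicross D) :=
  ⟨fun x y => of D (mulMap D ((of D).symm x ⊗ₜ[k] (of D).symm y))⟩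

instance : One (Bicross D) := ⟨tm D 1 1⟩

theorem one_eq : (1 : Bicross D) = tm D 1 1 := rfl

theorem mul_eq (x y : Bicross D) :
    x * y = of D (mulMap D ((of D).symm x ⊗ₜ[k] (of D).symm y)) := rfl

theorem tm_mul_tm (m n : M) (h g : H) : tm D m h * tm D n g =
    of D (TensorProduct.map (LinearMap.mulLeft k m ∘ₗ D.act.toLinearMap.flip n)
      (LinearMap.mulRight k g) (Coalgebra.comul h)) := by
  simp only [mul_eq, tm, LinearEquiv.symm_apply_apply, mulMap, cross, LinearMap.comp_apply,
    LinearEquiv.coe_coe, TensorProduct.assoc_tmul, LinearMap.lTensor_tmul,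
    TensorProduct.assoc_symm_tmul, LinearMap.rTensor_tmul]
  congr 1
  induction Coalgebra.comul (R := k) h with
  | zero => simp
  | tmul a b => simp
  | add a b ha hb => simp only [TensorProduct.add_tmul, TensorProduct.tmul_add, map_add, ha, hb]

theorem zero_mul_aux (y : Bicross D) : 0 * y = 0 := by simp [mul_eq]
theorem mul_zero_aux (y : Bicross D) : y * 0 = 0 := by simp [mul_eq]
theorem add_mul_aux (x y z : Bicross D) : (x + y) * z = x * z + y * z := by
  simp [mul_eq, TensorProduct.add_tmul]
theorem mul_add_aux (x y z : Bicross D) : x * (y + z) = x * y + x * z := by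
  simp [mul_eq, TensorProduct.tmul_add]
theorem smul_mul_aux (c : k) (x y : Bicross D) : (c • x) * y = c • (x * y) := by
  simp [mul_eq, ← TensorProduct.smul_tmul']
theorem mul_smul_aux (c : k) (x y : Bicross D) : x * (c • y) = c • (x * y) := by
  simp [mul_eq]

section lift

variable {A : Type*} [Semiring A] [Algebra k A] (l : M →ₐ[k] A) (r : H →ₐ[k] A)

/-- `m ⊗ h ↦ l(m) r(h)` -/
def liftLin : Bicross D →ₗ[k] A :=
  LinearMap.mul' k A ∘ₗ TensorProduct.map l.toLinearMap r.toLinearMap ∘ₗ (of D).symm.toLinearMap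

theorem liftLin_tm (m : M) (h : H) : liftLin D l r (tm D m h) = l m * r h := by
  simp [liftLin, tm]

/-- The relation `r(h) l(n) = l(h₁ ▷ n) r(h₂)`. -/
def CrossRel : Prop := ∀ n, LinearMap.mulRight k (l n) ∘ₗ r.toLinearMap =
  conv (l.toLinearMap ∘ₗ D.act.toLinearMap.flip n) r.toLinearMap

variable {D l r}

theorem liftLin_mul (hlr : CrossRel D l r) (x y : Bicross D) :
    liftLin D l r (x * y) = liftLin D l r x * liftLin D l r y := by
  induction x using induction with
  | zero => simp [zero_mul_aux]
  | add x x' h h' => simp only [add_mul_aux, map_add, h, h', add_mul]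
  | tmul m h =>
  induction y using induction with
  | zero => simp [mul_zero_aux]
  | add x x' h h' => simp only [mul_add_aux, map_add, h, h', mul_add]
  | tmul n g =>
  have key := LinearMap.congr_fun (hlr n) h
  simp only [LinearMap.comp_apply, LinearMap.mulRight_apply, AlgHom.toLinearMap_apply,
    conv_apply] at key
  rw [liftLin_tm, liftLin_tm, mul_assoc, ← mul_assoc (r h), key, tm_mul_tm]
  induction Coalgebra.comul (R := k) h with
  | zero => simp
  | add a b ha hb => simp only [map_add, ha, hb, add_mul, mul_add]
  | tmul a b =>
    have := liftLin_tm D l r (m * D.act a n) (b * g)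
    simp only [tm] at this
    simp [this, mul_assoc]

theorem liftLin_one : liftLin D l r 1 = 1 := by simp [one_eq, liftLin_tm]

end lift

/-- `h ↦ (h₁ ▷ ·) ⊗ h₂` -/
def regH : H →ₐ[k] (Module.End k M) ⊗[k] H :=
  (Algebra.TensorProduct.map D.act (AlgHom.id k H)).comp (Bialgebra.comulAlgHom k H)

/-- `m ↦ (m ·) ⊗ 1` -/
def regM : M →ₐ[k] (Module.End k M) ⊗[k] H :=
  (Algebra.TensorProduct.includeLeft).comp (Algebra.lmul k M)

theorem reg_rel : CrossRel D (regM (H := H)) (regH D) := by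
  intro n
  have h1 : (regH D).toLinearMap = conv
      ((Algebra.TensorProduct.includeLeft : _ →ₐ[k] (Module.End k M) ⊗[k] H).toLinearMap ∘ₗ
        D.act.toLinearMap)
      (Algebra.TensorProduct.includeRight : _ →ₐ[k] (Module.End k M) ⊗[k] H).toLinearMap := by
    ext h
    simp only [conv_apply, regH, AlgHom.toLinearMap_apply, AlgHom.comp_apply,
      Bialgebra.comulAlgHom_apply]
    induction Coalgebra.comul (R := k) h with
    | zero => simp
    | add a b ha hb => simp only [map_add, ha, hb]
    | tmul a b => simp
  have h2 : LinearMap.mulRight k (Algebra.lmul k M n) ∘ₗ D.act.toLinearMap =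
      conv ((Algebra.lmul k M).toLinearMap ∘ₗ D.act.toLinearMap.flip n) D.act.toLinearMap := by
    ext h m
    have := LinearMap.congr_fun (D.act_mul n m) h
    simp only [conv_apply, LinearMap.flip_apply, AlgHom.toLinearMap_apply] at this
    simp only [LinearMap.comp_apply, AlgHom.toLinearMap_apply, LinearMap.mulRight_apply,
      Module.End.mul_apply, conv_apply]
    refine Eq.trans this ?_
    induction Coalgebra.comul (R := k) h with
    | zero => simp
    | add a b ha hb => simp only [map_add, ha, hb, LinearMap.add_apply]
    | tmul a b => simp
  set inc : Module.End k M →ₐ[k] (Module.End k M) ⊗[k] H := Algebra.TensorProduct.includeLeft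
    with hinc
  set inr : H →ₐ[k] (Module.End k M) ⊗[k] H := Algebra.TensorProduct.includeRight with hinr
  have h3 : LinearMap.mulRight k (regM (k := k) (H := H) n) ∘ₗ inr.toLinearMap =
      LinearMap.mulLeft k (regM (k := k) (H := H) n) ∘ₗ inr.toLinearMap := by
    ext h
    simp [hinr, regM]
  have h4 : LinearMap.mulRight k (regM (k := k) (H := H) n) ∘ₗ (inc.toLinearMap ∘ₗ D.act.toLinearMap) =
      inc.toLinearMap ∘ₗ (LinearMap.mulRight k (Algebra.lmul k M n) ∘ₗ D.act.toLinearMap) := by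
    ext h
    simp [hinc, regM]
  rw [h1, mulRight_comp_conv, h3, ← conv_mulRight_left, h4, h2, algHom_comp_conv, conv_assoc]
  rfl

theorem reg_injective : Function.Injective (liftLin D (regM (H := H)) (regH D)) := by
  have : ((LinearMap.applyₗ (1 : M)).rTensor H : (Module.End k M) ⊗[k] H →ₗ[k] M ⊗[k] H) ∘ₗ
      liftLin D (regM (H := H)) (regH D) = (of D).symm.toLinearMap := by
    apply LinearMap.ext
    intro x
    induction x using induction with
    | zero => simp
    | add x y hx hy => simp only [map_add, hx, hy]
    | tmul m h =>
      have key : TensorProduct.map (LinearMap.mulLeft k m ∘ₗ Algebra.linearMap k M ∘ₗ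
        Coalgebra.counit) LinearMap.id (Coalgebra.comul (R := k) h) = m ⊗ₜ h := by
        rw [← LinearMap.comp_assoc, ← LinearMap.map_comp_rTensor, LinearMap.comp_apply,
          Coalgebra.rTensor_counit_comul]
        simp
      rw [LinearMap.comp_apply, liftLin_tm, LinearEquiv.coe_coe, tm,
        LinearEquiv.symm_apply_apply]
      refine Eq.trans ?_ key
      simp only [regH, AlgHom.comp_apply, Bialgebra.comulAlgHom_apply]
      induction Coalgebra.comul (R := k) h with
      | zero => simp
      | add a b ha hb => simp only [map_add, ha, hb, mul_add]
      | tmul a b => simp [regM, D.act_one]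
  intro x y hxy
  apply (of D).symm.injective
  have h1 := LinearMap.congr_fun this x
  have h2 := LinearMap.congr_fun this y
  simp only [LinearMap.comp_apply, LinearEquiv.coe_coe] at h1 h2
  rw [← h1, ← h2, hxy]

instance : Ring (Bicross D) :=
  { (inferInstance : AddCommGroup (Bicross D)) with
    left_distrib := mul_add_aux D
    right_distrib := add_mul_aux D
    zero_mul := zero_mul_aux D
    mul_zero := mul_zero_aux D
    mul_assoc := fun x y z =>
      reg_injective D (by simp only [liftLin_mul (reg_rel D), mul_assoc])
    one_mul := fun x =>
      reg_injective D (by simp only [liftLin_mul (reg_rel D), liftLin_one, one_mul])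
    mul_one := fun x =>
      reg_injective D (by simp only [liftLin_mul (reg_rel D), liftLin_one, mul_one]) }

instance : Algebra k (Bicross D) := Algebra.ofModule (smul_mul_aux D) (mul_smul_aux D)

/-- The inclusion `m ↦ m ⊗ 1` of `M` in `M ▶◁ H`. -/
def incl : M →ₐ[k] Bicross D :=
  AlgHom.ofLinearMap ((of D).toLinearMap ∘ₗ (TensorProduct.mk k M H).flip 1) rfl (by
    intro m n
    change tm D (m * n) 1 = tm D m 1 * tm D n 1
    rw [tm_mul_tm]
    simp [tm, Algebra.TensorProduct.one_def])

/-- The trivialisation `Φ(h) = 1 ⊗ h`. -/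
def Phi : H →ₐ[k] Bicross D :=
  AlgHom.ofLinearMap ((of D).toLinearMap ∘ₗ TensorProduct.mk k M H 1) rfl (by
    intro h g
    change tm D 1 (h * g) = tm D 1 h * tm D 1 g
    rw [tm_mul_tm, tm]
    congr 1
    have : (LinearMap.mulLeft k 1 ∘ₗ D.act.toLinearMap.flip 1 : H →ₗ[k] M) =
        Algebra.linearMap k M ∘ₗ Coalgebra.counit := by
      ext h; simp [D.act_one]
    rw [this, ← LinearMap.map_comp_rTensor, LinearMap.comp_apply,
      Coalgebra.rTensor_counit_comul]
    simp)

theorem incl_apply (m : M) : incl D m = tm D m 1 := rfl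
theorem Phi_apply (h : H) : Phi D h = tm D 1 h := rfl

theorem incl_mul_Phi (m : M) (h : H) : incl D m * Phi D h = tm D m h := by
  rw [incl_apply, Phi_apply, tm_mul_tm]
  simp [tm, Algebra.TensorProduct.one_def]

theorem algHom_ext {A : Type*} [Semiring A] [Algebra k A] {f g : Bicross D →ₐ[k] A}
    (h1 : f.comp (incl D) = g.comp (incl D)) (h2 : f.comp (Phi D) = g.comp (Phi D)) : f = g := by
  ext x
  induction x using induction with
  | zero => simp
  | add x y hx hy => simp only [map_add, hx, hy]
  | tmul m h =>
    rw [← incl_mul_Phi, map_mul, map_mul]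
    exact congrArg₂ _ (DFunLike.congr_fun h1 m) (DFunLike.congr_fun h2 h)

/-- The algebra map `m ⊗ h ↦ l(m) r(h)`. -/
def lift {A : Type*} [Semiring A] [Algebra k A] (l : M →ₐ[k] A) (r : H →ₐ[k] A)
    (hlr : CrossRel D l r) : Bicross D →ₐ[k] A :=
  AlgHom.ofLinearMap (liftLin D l r) liftLin_one (liftLin_mul hlr)

theorem lift_tm {A : Type*} [Semiring A] [Algebra k A] (l : M →ₐ[k] A) (r : H →ₐ[k] A)
    (hlr : CrossRel D l r) (m : M) (h : H) : lift D l r hlr (tm D m h) = l m * r h :=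
  liftLin_tm D l r m h

theorem lift_incl {A : Type*} [Semiring A] [Algebra k A] (l : M →ₐ[k] A) (r : H →ₐ[k] A)
    (hlr : CrossRel D l r) (m : M) : lift D l r hlr (incl D m) = l m := by
  rw [incl_apply, lift_tm, map_one, mul_one]

theorem lift_Phi {A : Type*} [Semiring A] [Algebra k A] (l : M →ₐ[k] A) (r : H →ₐ[k] A)
    (hlr : CrossRel D l r) (h : H) : lift D l r hlr (Phi D h) = r h := by
  rw [Phi_apply, lift_tm, map_one, one_mul]

/-- `Φ(h) n = (h₁ ▷ n) Φ(h₂)` -/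
theorem Phi_rel : CrossRel D (incl D) (Phi D) := by
  intro n
  ext h
  simp only [LinearMap.comp_apply, LinearMap.mulRight_apply, AlgHom.toLinearMap_apply, conv_apply]
  rw [Phi_apply, incl_apply, tm_mul_tm]
  induction Coalgebra.comul (R := k) h with
  | zero => simp
  | add a b ha hb => simp only [map_add, ha, hb]
  | tmul a b =>
    have := incl_mul_Phi D (D.act a n) b
    rw [tm] at this
    simp [this]

/-- The counit `ε(m ⊗ h) = ε(m) ε(h)`. -/
def counitHom : Bicross D →ₐ[k] k :=
  lift D (Bialgebra.counitAlgHom k M) (Bialgebra.counitAlgHom k H) (by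
    intro n
    ext h
    have h1 : ((Bialgebra.counitAlgHom k M).toLinearMap ∘ₗ D.act.toLinearMap.flip n) =
        LinearMap.mulRight k (Coalgebra.counit (R := k) n) ∘ₗ
          (Bialgebra.counitAlgHom k H).toLinearMap := by
      ext h; simp [D.counit_act]
    rw [h1, conv_mulRight_left]
    have h2 : Coalgebra.counit (R := k) h = LinearMap.mul' k k (TensorProduct.map
        Coalgebra.counit LinearMap.id (LinearMap.lTensor H Coalgebra.counit
          (Coalgebra.comul (R := k) h))) := by
      rw [Coalgebra.lTensor_counit_comul]; simp
    simp only [LinearMap.comp_apply, conv_apply, LinearMap.mulRight_apply,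
      AlgHom.toLinearMap_apply, Bialgebra.counitAlgHom_apply]
    conv_lhs => rw [h2]
    induction Coalgebra.comul (R := k) h with
    | zero => simp
    | add a b ha hb => simp only [map_add, ha, hb, add_mul]
    | tmul a b => simp [mul_comm, mul_left_comm])

/-- The algebra map `h ⊗ m ↦ Φ(h) ⊗ m` from `H ⊗ M` to `(M ▶◁ H) ⊗ (M ▶◁ H)`. -/
def PhiIncl : H ⊗[k] M →ₐ[k] Bicross D ⊗[k] Bicross D :=
  Algebra.TensorProduct.map (Phi D) (incl D)

/-- `h ↦ Φ(h⁽¹⁾) ⊗ h⁽²⁾` -/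
def coactP : H →ₗ[k] Bicross D ⊗[k] Bicross D := (PhiIncl D).toLinearMap ∘ₗ D.coact

/-- `h ↦ 1 ⊗ Φ(h)` -/
def oneP : H →ₐ[k] Bicross D ⊗[k] Bicross D :=
  (Algebra.TensorProduct.includeRight).comp (Phi D)

theorem oneP_rel (t : H ⊗[k] M) : LinearMap.mulRight k (PhiIncl D t) ∘ₗ (oneP D).toLinearMap =
    conv ((PhiIncl D).toLinearMap ∘ₗ
      (LinearMap.lTensorHom H ∘ₗ D.act.toLinearMap).flip t) (oneP D).toLinearMap := by
  ext h
  induction t with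
  | zero => simp [conv_apply]
  | add a b ha hb =>
    simp only [LinearMap.comp_apply, LinearMap.mulRight_apply, conv_apply, map_add,
      mul_add, LinearMap.comp_add, TensorProduct.map_add_left, LinearMap.add_apply] at ha hb ⊢
    rw [ha, hb]
  | tmul g n =>
    have key := LinearMap.congr_fun (Phi_rel D n) h
    simp only [LinearMap.comp_apply, LinearMap.mulRight_apply, AlgHom.toLinearMap_apply,
      conv_apply] at key
    simp only [LinearMap.comp_apply, LinearMap.mulRight_apply, AlgHom.toLinearMap_apply,
      conv_apply, oneP, PhiIncl, AlgHom.comp_apply, Algebra.TensorProduct.map_tmul,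
      Algebra.TensorProduct.includeRight_apply, Algebra.TensorProduct.tmul_mul_tmul, one_mul, key]
    induction Coalgebra.comul (R := k) h with
    | zero => simp
    | add a b ha hb => simp only [map_add, TensorProduct.tmul_add, ha, hb]
    | tmul a b => simp

/-- `h ↦ Φ(h₁⁽¹⁾) ⊗ h₁⁽²⁾ Φ(h₂)`, the coproduct of `Φ(h)`. -/
def comulPhi : H →ₐ[k] Bicross D ⊗[k] Bicross D :=
  AlgHom.ofLinearMap (conv (coactP D) (oneP D).toLinearMap)
    (by
      rw [conv_apply, Bialgebra.comul_one, Algebra.TensorProduct.one_def, TensorProduct.map_tmul]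
      simp [coactP, D.coact_one])
    (by
      intro g h
      have key : ∀ x, conv (coactP D ∘ₗ LinearMap.mulRight k x) (oneP D).toLinearMap g =
          conv (coactP D) (oneP D).toLinearMap g * coactP D x := by
        intro x
        have h1 : coactP D ∘ₗ LinearMap.mulRight k x = conv (coactP D) ((PhiIncl D).toLinearMap ∘ₗ
            (LinearMap.lTensorHom H ∘ₗ D.act.toLinearMap).flip (D.coact x)) := by
          rw [coactP, LinearMap.comp_assoc, D.coact_mul, algHom_comp_conv]
        rw [h1, conv_assoc, ← oneP_rel, ← mulRight_comp_conv]
        rfl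
      rw [conv_apply _ _ (g * h), conv_apply _ _ h, Bialgebra.comul_mul]
      induction Coalgebra.comul (R := k) h with
      | zero => simp
      | add a b ha hb => simp only [map_add, mul_add, ha, hb]
      | tmul x y =>
        simp only [TensorProduct.map_tmul, LinearMap.mul'_apply, ← mul_assoc, ← key]
        rw [conv_apply]
        induction Coalgebra.comul (R := k) g with
        | zero => simp
        | add a b ha hb => simp only [map_add, add_mul, ha, hb]
        | tmul a b => simp [mul_assoc])

theorem comulPhi_toLinearMap :
    (comulPhi D).toLinearMap = conv (coactP D) (oneP D).toLinearMap := rfl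

/-- `m ↦ m₁ ⊗ m₂`, the coproduct of `M` in `(M ▶◁ H) ⊗ (M ▶◁ H)`. -/
def comulIncl : M →ₐ[k] Bicross D ⊗[k] Bicross D :=
  (Algebra.TensorProduct.map (incl D) (incl D)).comp (Bialgebra.comulAlgHom k M)

/-- `h ↦ (h⁽¹⁾ ▷ m) ⊗ h⁽²⁾` -/
def actCoactP (m : M) : H →ₗ[k] Bicross D ⊗[k] Bicross D :=
  (Algebra.TensorProduct.map (incl D) (incl D)).toLinearMap ∘ₗ
    (D.act.toLinearMap.flip m).rTensor M ∘ₗ D.coact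

/-- `h ↦ 1 ⊗ (h ▷ n)` -/
def oneAct (n : M) : H →ₗ[k] Bicross D ⊗[k] Bicross D :=
  ((Algebra.TensorProduct.includeRight).comp (incl D)).toLinearMap ∘ₗ D.act.toLinearMap.flip n

theorem coactP_mul (m : M) : LinearMap.mulRight k (incl D m ⊗ₜ[k] 1) ∘ₗ coactP D =
    conv (actCoactP D m) (coactP D) := by
  let f : (H ⊗[k] H) ⊗[k] M →ₗ[k] Bicross D ⊗[k] Bicross D :=
    TensorProduct.map (LinearMap.mul' k _ ∘ₗ TensorProduct.map
      ((incl D).toLinearMap ∘ₗ D.act.toLinearMap.flip m) (Phi D).toLinearMap) (incl D).toLinearMap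
  have h1 : LinearMap.mulRight k (incl D m ⊗ₜ[k] 1) ∘ₗ coactP D =
      f ∘ₗ (Coalgebra.comul (R := k) (A := H)).rTensor M ∘ₗ D.coact := by
    ext h
    simp only [LinearMap.comp_apply, coactP]
    induction D.coact h with
    | zero => simp
    | add a b ha hb => simp only [map_add, ha, hb]
    | tmul g n =>
      have key := LinearMap.congr_fun (Phi_rel D m) g
      simp only [LinearMap.comp_apply, LinearMap.mulRight_apply, AlgHom.toLinearMap_apply,
        conv_apply] at key
      simp [f, PhiIncl, key]
  rw [h1, D.comul_coact]
  ext h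
  simp only [LinearMap.comp_apply, conv_apply]
  induction Coalgebra.comul (R := k) h with
  | zero => simp
  | add a b ha hb => simp only [map_add, ha, hb]
  | tmul x y =>
    simp only [TensorProduct.map_tmul, LinearMap.mul'_apply, LinearMap.comp_apply, actCoactP,
      coactP]
    induction D.coact x with
    | zero => simp
    | add a b ha hb => simp only [map_add, add_mul, ha, hb]
    | tmul x1 x2 =>
      induction D.coact y with
      | zero => simp
      | add a b ha hb => simp only [map_add, mul_add, ha, hb]
      | tmul y1 y2 => simp [f, PhiIncl]

theorem oneP_mul (n : M) : LinearMap.mulRight k ((1 : Bicross D) ⊗ₜ[k] incl D n) ∘ₗ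
    (oneP D).toLinearMap = conv (oneAct D n) (oneP D).toLinearMap := by
  have h1 := congrArg (fun f => (Algebra.TensorProduct.includeRight :
    _ →ₐ[k] Bicross D ⊗[k] Bicross D).toLinearMap ∘ₗ f) (Phi_rel D n)
  simp only [algHom_comp_conv] at h1
  refine Eq.trans ?_ h1
  ext h
  simp [oneP]

theorem coactP_oneAct (n : M) : conv (coactP D) (oneAct D n) =
    conv (oneAct D n) (coactP D) := by
  have h1 := congrArg (fun f => (PhiIncl D).toLinearMap ∘ₗ f) (D.act_coact n)
  simp only [algHom_comp_conv] at h1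
  have h2 : (PhiIncl D).toLinearMap ∘ₗ (Algebra.TensorProduct.includeRight :
      M →ₐ[k] H ⊗[k] M).toLinearMap ∘ₗ D.act.toLinearMap.flip n = oneAct D n := by
    ext h
    simp [oneAct, PhiIncl]
  rw [h2] at h1
  exact h1.symm

theorem comul_rel : CrossRel D (comulIncl D) (comulPhi D) := by
  intro n
  have key : ∀ m n : M, LinearMap.mulRight k (incl D m ⊗ₜ[k] incl D n) ∘ₗ
      (comulPhi D).toLinearMap =
      conv (conv (actCoactP D m) (oneAct D n)) (comulPhi D).toLinearMap := by
    intro m n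
    have h1 : LinearMap.mulRight k (incl D m ⊗ₜ[k] incl D n) ∘ₗ (oneP D).toLinearMap =
        LinearMap.mulLeft k (incl D m ⊗ₜ[k] 1) ∘ₗ
          LinearMap.mulRight k ((1 : Bicross D) ⊗ₜ[k] incl D n) ∘ₗ (oneP D).toLinearMap := by
      ext h
      simp [oneP]
    rw [comulPhi_toLinearMap, mulRight_comp_conv, h1, ← conv_mulRight_left, coactP_mul,
      oneP_mul, conv_assoc, ← conv_assoc (coactP D), coactP_oneAct, conv_assoc, conv_assoc]
  have h2 : ∀ t : M ⊗[k] M, LinearMap.mulRight k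
      (Algebra.TensorProduct.map (incl D) (incl D) t) ∘ₗ (comulPhi D).toLinearMap =
      conv ((Algebra.TensorProduct.map (incl D) (incl D)).toLinearMap ∘ₗ
        ((conv (A := Module.End k (M ⊗[k] M))
      (TensorProduct.homTensorHomMap (RingHom.id k) M M M M ∘ₗ
        TensorProduct.map D.act.toLinearMap (LinearMap.mul k M) ∘ₗ D.coact)
      (LinearMap.lTensorHom M ∘ₗ D.act.toLinearMap)).flip t)) (comulPhi D).toLinearMap := by
    intro t
    ext h
    induction t with
    | zero => simp [conv_apply]
    | add a b ha hb =>
      simp only [LinearMap.comp_apply, LinearMap.mulRight_apply, conv_apply _ _ h, map_add,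
        mul_add, LinearMap.comp_add, TensorProduct.map_add_left, LinearMap.add_apply] at ha hb ⊢
      rw [ha, hb]
    | tmul m n =>
      rw [Algebra.TensorProduct.map_tmul, key]
      congr 2
      ext h
      simp only [LinearMap.comp_apply, LinearMap.flip_apply, conv_apply]
      induction Coalgebra.comul (R := k) h with
      | zero => simp
      | add a b ha hb => simp only [map_add, ha, hb, LinearMap.add_apply]
      | tmul x y =>
        simp only [TensorProduct.map_tmul, LinearMap.mul'_apply, LinearMap.comp_apply,
          actCoactP, oneAct]
        induction D.coact x with
        | zero => simp
        | add a b ha hb =>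
          simp only [map_add, add_mul, ha, hb, LinearMap.add_apply]
        | tmul x1 x2 => simp
  have h3 := h2 (Coalgebra.comul n)
  refine h3.trans (congrArg (fun f => conv f (comulPhi D).toLinearMap) ?_)
  ext h
  simp only [LinearMap.comp_apply, LinearMap.flip_apply]
  rw [← D.comul_act]
  rfl

/-- The cross coproduct `Δ(m ⊗ h) = m₁ ⊗ h₁⁽¹⁾ ⊗ m₂ h₁⁽²⁾ ⊗ h₂`. -/
def comulHom : Bicross D →ₐ[k] Bicross D ⊗[k] Bicross D :=
  lift D (comulIncl D) (comulPhi D) (comul_rel D)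

theorem comulHom_incl (m : M) : comulHom D (incl D m) =
    Algebra.TensorProduct.map (incl D) (incl D) (Coalgebra.comul m) := lift_incl ..

theorem comulHom_Phi (h : H) : comulHom D (Phi D h) = comulPhi D h := lift_Phi ..

theorem counitHom_incl (m : M) : counitHom D (incl D m) = Coalgebra.counit m := lift_incl ..

theorem counitHom_Phi (h : H) : counitHom D (Phi D h) = Coalgebra.counit h := lift_Phi ..

theorem coassoc_aux : (Algebra.TensorProduct.assoc k k k _ _ _).toAlgHom.comp
      ((Algebra.TensorProduct.map (comulHom D) (.id k (Bicross D))).comp (comulHom D))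
      = (Algebra.TensorProduct.map (.id k (Bicross D)) (comulHom D)).comp (comulHom D) := by
  apply algHom_ext
  · ext m
    have key := congrArg (Algebra.TensorProduct.map (incl D)
      (Algebra.TensorProduct.map (incl D) (incl D))) (Coalgebra.coassoc_apply (R := k) m)
    simp only [AlgHom.comp_apply, comulHom_incl]
    refine Eq.trans (Eq.trans ?_ key) ?_
    · induction Coalgebra.comul (R := k) m with
      | zero => simp
      | add a b ha hb => simp only [map_add, ha, hb]
      | tmul a b =>
        simp only [Algebra.TensorProduct.map_tmul, comulHom_incl, LinearMap.rTensor_tmul]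
        induction Coalgebra.comul (R := k) a with
        | zero => simp
        | add a b ha hb => simp only [map_add, TensorProduct.add_tmul, ha, hb]
        | tmul a a' => simp
    · induction Coalgebra.comul (R := k) m with
      | zero => simp
      | add a b ha hb => simp only [map_add, ha, hb]
      | tmul a b => simp [comulHom_incl]
  · apply AlgHom.toLinearMap_injective
    set as : (Bicross D ⊗[k] Bicross D) ⊗[k] Bicross D →ₐ[k]
        Bicross D ⊗[k] (Bicross D ⊗[k] Bicross D) :=
      (Algebra.TensorProduct.assoc k k k _ _ _).toAlgHom with has
    set f1 := as.comp (Algebra.TensorProduct.map (comulHom D) (.id k (Bicross D))) with hf1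
    set f2 := Algebra.TensorProduct.map (.id k (Bicross D)) (comulHom D) with hf2
    set inr : Bicross D ⊗[k] Bicross D →ₐ[k] Bicross D ⊗[k] (Bicross D ⊗[k] Bicross D) :=
      Algebra.TensorProduct.includeRight with hinr
    have e1 : (((as.comp ((Algebra.TensorProduct.map (comulHom D) (.id k (Bicross D))).comp
        (comulHom D))).comp (Phi D))).toLinearMap = f1.toLinearMap ∘ₗ (comulPhi D).toLinearMap := by
      ext h
      simp [f1, comulHom_Phi]
    have e2 : ((f2.comp (comulHom D)).comp (Phi D)).toLinearMap =
        f2.toLinearMap ∘ₗ (comulPhi D).toLinearMap := by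
      ext h
      simp [comulHom_Phi]
    rw [e1, e2, comulPhi_toLinearMap, algHom_comp_conv, algHom_comp_conv]
    have e3 : f2.toLinearMap ∘ₗ (oneP D).toLinearMap = inr.toLinearMap ∘ₗ
        (comulPhi D).toLinearMap := by
      ext h
      simp [f2, oneP, comulHom_Phi, inr]
    have e4 : f1.toLinearMap ∘ₗ (oneP D).toLinearMap = inr.toLinearMap ∘ₗ
        (oneP D).toLinearMap := by
      ext h
      simp [f1, oneP, inr, as, Algebra.TensorProduct.one_def]
    rw [e3, e4, comulPhi_toLinearMap, algHom_comp_conv, ← conv_assoc]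
    congr 1
    -- the map `(h ⊗ g) ⊗ m ↦ Δ(Φ h)`-part
    let F : (H ⊗[k] H) ⊗[k] M →ₗ[k] Bicross D ⊗[k] (Bicross D ⊗[k] Bicross D) :=
      as.toLinearMap ∘ₗ TensorProduct.map (LinearMap.mul' k _ ∘ₗ
        TensorProduct.map (coactP D) (oneP D).toLinearMap) (incl D).toLinearMap
    have e5 : f1.toLinearMap ∘ₗ coactP D =
        F ∘ₗ (Coalgebra.comul (R := k) (A := H)).rTensor M ∘ₗ D.coact := by
      ext h
      simp only [coactP, LinearMap.comp_apply]
      induction D.coact h with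
      | zero => simp
      | add a b ha hb => simp only [map_add, ha, hb]
      | tmul g n =>
        have : comulPhi D g = LinearMap.mul' k _ (TensorProduct.map (coactP D)
          (oneP D).toLinearMap (Coalgebra.comul g)) := rfl
        simp [f1, PhiIncl, comulHom_Phi, this, as, F]
    -- `h ↦ Φ(h⁽¹⁾) ⊗ Δ(h⁽²⁾)`
    have e6 : f2.toLinearMap ∘ₗ coactP D = as.toLinearMap ∘ₗ
        (TensorProduct.map (coactP D) (incl D).toLinearMap) ∘ₗ D.coact := by
      ext h
      have key := congrArg (TensorProduct.map (Phi D).toLinearMap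
        (TensorProduct.map (incl D).toLinearMap (incl D).toLinearMap)) (D.coact_coassoc h)
      simp only [coactP, LinearMap.comp_apply]
      refine Eq.trans (Eq.trans ?_ key.symm) ?_
      · induction D.coact h with
        | zero => simp
        | add a b ha hb => simp only [map_add, ha, hb]
        | tmul g n =>
          simp only [f2, PhiIncl, AlgHom.toLinearMap_apply, Algebra.TensorProduct.map_tmul,
            comulHom_incl, LinearMap.lTensor_tmul, TensorProduct.map_tmul, AlgHom.id_apply]
          rfl
      · induction D.coact h with
        | zero => simp
        | add a b ha hb => simp only [map_add, ha, hb]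
        | tmul g n =>
          simp only [LinearMap.rTensor_tmul, TensorProduct.map_tmul, LinearMap.comp_apply]
          induction D.coact g with
          | zero => simp
          | add a b ha hb => simp only [map_add, TensorProduct.add_tmul, ha, hb]
          | tmul a b => simp [as, PhiIncl]
    rw [e5, e6, D.comul_coact]
    ext h
    simp only [LinearMap.comp_apply, conv_apply]
    induction Coalgebra.comul (R := k) h with
    | zero => simp
    | add a b ha hb => simp only [map_add, ha, hb]
    | tmul x y =>
      simp only [TensorProduct.map_tmul, LinearMap.mul'_apply, LinearMap.comp_apply]
      have e7 : ∀ t : H ⊗[k] M, inr.toLinearMap (PhiIncl D t) = (1 : Bicross D) ⊗ₜ[k]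
        PhiIncl D t := fun t => rfl
      have e8 : coactP D y = PhiIncl D (D.coact y) := rfl
      rw [e8, e7]
      induction D.coact x with
      | zero => simp
      | add a b ha hb => simp only [map_add, add_mul, ha, hb]
      | tmul x1 x2 =>
        induction D.coact y with
        | zero => simp
        | add a b ha hb =>
          simp only [map_add, mul_add, TensorProduct.tmul_add, ha, hb]
        | tmul y1 y2 =>
          simp only [F, LinearMap.comp_apply, TensorProduct.map_tmul, AlgHom.toLinearMap_apply,
            Algebra.TensorProduct.map_tmul, Algebra.TensorProduct.includeLeft_apply,
            Algebra.TensorProduct.includeRight_apply, Algebra.TensorProduct.tmul_mul_tmul,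
            AlgHom.id_apply, mul_one, one_mul, LinearMap.mul'_apply, map_mul]
          induction coactP D x1 with
          | zero => simp
          | add a b ha hb => simp only [map_add, add_mul, TensorProduct.add_tmul, ha, hb]
          | tmul p q => simp [oneP, PhiIncl, as]

theorem counit_left_aux : (Algebra.TensorProduct.map (counitHom D) (.id k (Bicross D))).comp
    (comulHom D) = (Algebra.TensorProduct.lid k (Bicross D)).symm := by
  apply algHom_ext
  · ext m
    have key := congrArg (TensorProduct.map LinearMap.id (incl D).toLinearMap)
      (Coalgebra.rTensor_counit_comul (R := k) m)
    simp only [AlgHom.comp_apply, comulHom_incl]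
    refine Eq.trans (Eq.trans ?_ key) ?_
    · induction Coalgebra.comul (R := k) m with
      | zero => simp
      | add a b ha hb => simp only [map_add, ha, hb]
      | tmul a b => simp [counitHom_incl]
    · simp
  · ext h
    have e1 : (Algebra.TensorProduct.map (counitHom D) (.id k (Bicross D))).toLinearMap ∘ₗ
        coactP D = Algebra.linearMap k _ ∘ₗ Coalgebra.counit := by
      ext h
      have key := congrArg (fun x => (1 : k) ⊗ₜ[k] incl D x) (D.counit_coact h)
      simp only [coactP, LinearMap.comp_apply]
      refine Eq.trans (Eq.trans ?_ key) ?_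
      · induction D.coact h with
        | zero => simp
        | add a b ha hb => simp only [map_add, TensorProduct.tmul_add, ha, hb]
        | tmul a b =>
          simp [PhiIncl, counitHom_Phi, TensorProduct.smul_tmul']
      · simp [Algebra.algebraMap_eq_smul_one, Algebra.TensorProduct.one_def]
    have e2 := LinearMap.congr_fun (algHom_comp_conv (Algebra.TensorProduct.map (counitHom D)
      (.id k (Bicross D))) (coactP D) (oneP D).toLinearMap) h
    rw [e1] at e2
    have key := congrArg (TensorProduct.map LinearMap.id (Phi D).toLinearMap)
      (Coalgebra.rTensor_counit_comul (R := k) h)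
    simp only [AlgHom.comp_apply, comulHom_Phi]
    refine Eq.trans e2 (Eq.trans (Eq.trans ?_ key) ?_)
    · rw [conv_apply]
      induction Coalgebra.comul (R := k) h with
      | zero => simp
      | add a b ha hb => simp only [map_add, ha, hb]
      | tmul a b => simp [oneP, Algebra.algebraMap_eq_smul_one, TensorProduct.smul_tmul']
    · simp

theorem counit_right_aux : (Algebra.TensorProduct.map (.id k (Bicross D)) (counitHom D)).comp
    (comulHom D) = (Algebra.TensorProduct.rid k k (Bicross D)).symm := by
  apply algHom_ext
  · ext m
    have key := congrArg (TensorProduct.map (incl D).toLinearMap LinearMap.id)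
      (Coalgebra.lTensor_counit_comul (R := k) m)
    simp only [AlgHom.comp_apply, comulHom_incl]
    refine Eq.trans (Eq.trans ?_ key) ?_
    · induction Coalgebra.comul (R := k) m with
      | zero => simp
      | add a b ha hb => simp only [map_add, ha, hb]
      | tmul a b => simp [counitHom_incl]
    · simp
  · ext h
    have e1 : (Algebra.TensorProduct.map (.id k (Bicross D)) (counitHom D)).toLinearMap ∘ₗ
        coactP D = (TensorProduct.mk k _ k).flip 1 ∘ₗ (Phi D).toLinearMap := by
      ext h
      have key := congrArg (fun x => Phi D x ⊗ₜ[k] (1 : k)) (D.coact_counit h)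
      simp only [coactP, LinearMap.comp_apply]
      refine Eq.trans (Eq.trans ?_ key) ?_
      · induction D.coact h with
        | zero => simp
        | add a b ha hb => simp only [map_add, TensorProduct.add_tmul, ha, hb]
        | tmul a b =>
          simp [PhiIncl, counitHom_incl, TensorProduct.smul_tmul]
      · simp
    have e2 := LinearMap.congr_fun (algHom_comp_conv (Algebra.TensorProduct.map
      (.id k (Bicross D)) (counitHom D)) (coactP D) (oneP D).toLinearMap) h
    rw [e1] at e2
    have key := congrArg (TensorProduct.map (Phi D).toLinearMap LinearMap.id)
      (Coalgebra.lTensor_counit_comul (R := k) h)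
    simp only [AlgHom.comp_apply, comulHom_Phi]
    refine Eq.trans e2 (Eq.trans (Eq.trans ?_ key) ?_)
    · rw [conv_apply]
      induction Coalgebra.comul (R := k) h with
      | zero => simp
      | add a b ha hb => simp only [map_add, ha, hb]
      | tmul a b => simp [oneP, counitHom_Phi]
    · simp

instance : Bialgebra k (Bicross D) :=
  Bialgebra.ofAlgHom (comulHom D) (counitHom D) (coassoc_aux D) (counit_left_aux D)
    (counit_right_aux D)

theorem comul_def : (Coalgebra.comul : Bicross D →ₗ[k] _) = (comulHom D).toLinearMap := rfl

theorem counit_def : (Coalgebra.counit : Bicross D →ₗ[k] k) = (counitHom D).toLinearMap := rfl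

theorem comul_tm (m : M) (h : H) : Coalgebra.comul (R := k) (tm D m h) =
    comulIncl D m * comulPhi D h :=
  lift_tm D _ _ (comul_rel D) m h

theorem counit_tm (m : M) (h : H) : Coalgebra.counit (R := k) (tm D m h) =
    Coalgebra.counit (R := k) m * Coalgebra.counit (R := k) h :=
  liftLin_tm D (Bialgebra.counitAlgHom k M) (Bialgebra.counitAlgHom k H) m h

/-- `h ↦ Φ(S h⁽¹⁾) S(h⁽²⁾)`, the antipode of `Φ(h)`. -/
def antipodePhi : H →ₗ[k] Bicross D :=
  LinearMap.mul' k (Bicross D) ∘ₗ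
    TensorProduct.map ((Phi D).toLinearMap ∘ₗ HopfAlgebra.antipode k)
      ((incl D).toLinearMap ∘ₗ HopfAlgebra.antipode k) ∘ₗ D.coact

/-- The antipode `S(m ⊗ h) = Φ(S h⁽¹⁾) S(m h⁽²⁾)` of `M ▶◁ H`, written with
`S(m h⁽²⁾) = S(h⁽²⁾) S(m)`. -/
def antipodeMap : Bicross D →ₗ[k] Bicross D :=
  LinearMap.mul' k (Bicross D) ∘ₗ
    TensorProduct.map (antipodePhi D) ((incl D).toLinearMap ∘ₗ HopfAlgebra.antipode k) ∘ₗ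
    (TensorProduct.comm k M H).toLinearMap ∘ₗ (of D).symm.toLinearMap

theorem antipodeMap_tm (m : M) (h : H) : antipodeMap D (tm D m h) =
    antipodePhi D h * incl D (HopfAlgebra.antipode k m) := by
  simp [antipodeMap, tm]

theorem antipodeMap_Phi (h : H) : antipodeMap D (Phi D h) = antipodePhi D h := by
  rw [Phi_apply, antipodeMap_tm, HopfAlgebra.antipode_one, map_one, mul_one]

theorem antipodeMap_incl_mul (m : M) (x : Bicross D) : antipodeMap D (incl D m * x) =
    antipodeMap D x * incl D (HopfAlgebra.antipode k m) := by
  induction x using induction with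
  | zero => simp
  | add x y hx hy => simp only [mul_add, map_add, hx, hy, add_mul]
  | tmul n h =>
    rw [← incl_mul_Phi, ← mul_assoc, ← map_mul, incl_mul_Phi, incl_mul_Phi, antipodeMap_tm,
      antipodeMap_tm, HopfAlgebra.antipode_mul_antidistrib, map_mul, mul_assoc]

theorem antipode_left_aux : LinearMap.mul' k (Bicross D) ∘ₗ
    (antipodeMap D).rTensor (Bicross D) ∘ₗ Coalgebra.comul =
      Algebra.linearMap k (Bicross D) ∘ₗ Coalgebra.counit := by
  set Q := LinearMap.mul' k (Bicross D) ∘ₗ (antipodeMap D).rTensor (Bicross D) with hQ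
  have h1 : ∀ m t, Q (comulIncl D m * t) = Coalgebra.counit (R := k) m • Q t := by
    intro m t
    induction t with
    | zero => simp
    | add a b ha hb => simp only [mul_add, map_add, ha, hb, smul_add]
    | tmul p q =>
      have key := congrArg (fun x => antipodeMap D p * incl D x * q)
        (HopfAlgebra.mul_antipode_rTensor_comul_apply (R := k) m)
      refine Eq.trans ?_ (Eq.trans key ?_)
      · simp only [comulIncl, AlgHom.comp_apply, Bialgebra.comulAlgHom_apply]
        induction Coalgebra.comul (R := k) m with
        | zero => simp
        | add a b ha hb => simp only [add_mul, mul_add, map_add, ha, hb]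
        | tmul a b => simp [Q, antipodeMap_incl_mul, mul_assoc]
      · simp [Q, Algebra.algebraMap_eq_smul_one]
  have h2 : Q ∘ₗ coactP D = (Phi D).toLinearMap ∘ₗ HopfAlgebra.antipode k := by
    ext h
    let G : H ⊗[k] (M ⊗[k] M) →ₗ[k] Bicross D := LinearMap.mul' k _ ∘ₗ
      TensorProduct.map ((Phi D).toLinearMap ∘ₗ HopfAlgebra.antipode k)
        ((incl D).toLinearMap ∘ₗ LinearMap.mul' k M ∘ₗ (HopfAlgebra.antipode k).rTensor M)
    have key := congrArg G (D.coact_coassoc h)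
    have key2 := congrArg (fun x => Phi D (HopfAlgebra.antipode k x)) (D.coact_counit h)
    simp only [LinearMap.comp_apply, coactP]
    refine Eq.trans ?_ (Eq.trans key (Eq.trans ?_ key2))
    · induction D.coact h with
      | zero => simp
      | add a b ha hb => simp only [map_add, ha, hb]
      | tmul g n =>
        simp only [PhiIncl, AlgHom.toLinearMap_apply, Algebra.TensorProduct.map_tmul, Q,
          LinearMap.comp_apply, LinearMap.rTensor_tmul, LinearMap.mul'_apply, antipodeMap_Phi,
          antipodePhi]
        induction D.coact g with
        | zero => simp
        | add a b ha hb => simp only [map_add, add_mul, TensorProduct.add_tmul, ha, hb]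
        | tmul a b => simp [G, mul_assoc]
    · induction D.coact h with
      | zero => simp
      | add a b ha hb => simp only [map_add, ha, hb]
      | tmul g n => simp [G, Algebra.algebraMap_eq_smul_one]
  have h3 : ∀ h, Q (comulPhi D h) = algebraMap k _ (Coalgebra.counit h) := by
    intro h
    have key := congrArg (Phi D) (HopfAlgebra.mul_antipode_rTensor_comul_apply (R := k) h)
    rw [AlgHom.commutes] at key
    refine Eq.trans ?_ key
    change Q (conv (coactP D) (oneP D).toLinearMap h) = _
    rw [conv_apply]
    induction Coalgebra.comul (R := k) h with
    | zero => simp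
    | add a b ha hb => simp only [map_add, ha, hb]
    | tmul x y =>
      have := LinearMap.congr_fun h2 x
      simp only [LinearMap.comp_apply, AlgHom.toLinearMap_apply] at this
      simp only [TensorProduct.map_tmul, LinearMap.mul'_apply, LinearMap.rTensor_tmul, map_mul,
        ← this]
      induction coactP D x with
      | zero => simp
      | add a b ha hb => simp only [map_add, add_mul, ha, hb]
      | tmul p q => simp [oneP, Q, mul_assoc]
  apply LinearMap.ext
  intro x
  induction x using induction with
  | zero => simp
  | add x y hx hy => simp only [map_add, hx, hy]
  | tmul m h =>
    refine Eq.trans (congrArg Q (comul_tm D m h)) (Eq.trans ?_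
      (congrArg (algebraMap k (Bicross D)) (counit_tm D m h)).symm)
    rw [h1, h3]
    simp [Algebra.smul_def]

theorem antipode_right_aux : LinearMap.mul' k (Bicross D) ∘ₗ
    (antipodeMap D).lTensor (Bicross D) ∘ₗ Coalgebra.comul =
      Algebra.linearMap k (Bicross D) ∘ₗ Coalgebra.counit := by
  set Q := LinearMap.mul' k (Bicross D) ∘ₗ (antipodeMap D).lTensor (Bicross D) with hQ
  let G : (H ⊗[k] H) ⊗[k] M →ₗ[k] Bicross D := LinearMap.mul' k _ ∘ₗ
      TensorProduct.map ((Phi D).toLinearMap ∘ₗ LinearMap.mul' k H ∘ₗ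
        (HopfAlgebra.antipode k).lTensor H) ((incl D).toLinearMap ∘ₗ HopfAlgebra.antipode k)
  have h3 : ∀ h, Q (comulPhi D h) = algebraMap k _ (Coalgebra.counit h) := by
    intro h
    have key := congrArg G (LinearMap.congr_fun D.comul_coact h)
    have key2 := congrArg (fun x => incl D (HopfAlgebra.antipode k x)) (D.counit_coact h)
    have e1 : incl D (HopfAlgebra.antipode k (algebraMap k M (Coalgebra.counit h))) =
        algebraMap k _ (Coalgebra.counit h) := by
      simp [Algebra.algebraMap_eq_smul_one]
    rw [e1] at key2
    refine Eq.trans ?_ (Eq.trans key.symm (Eq.trans ?_ key2))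
    · change Q (conv (coactP D) (oneP D).toLinearMap h) = _
      rw [conv_apply, conv_apply]
      induction Coalgebra.comul (R := k) h with
      | zero => simp
      | add a b ha hb => simp only [map_add, ha, hb]
      | tmul x y =>
        simp only [TensorProduct.map_tmul, LinearMap.mul'_apply, coactP, LinearMap.comp_apply]
        induction D.coact x with
        | zero => simp
        | add a b ha hb => simp only [map_add, add_mul, ha, hb]
        | tmul x1 x2 =>
          simp only [PhiIncl, oneP, AlgHom.toLinearMap_apply, Algebra.TensorProduct.map_tmul, Q,
            AlgHom.comp_apply, Algebra.TensorProduct.includeRight_apply,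
            Algebra.TensorProduct.tmul_mul_tmul, mul_one,
            LinearMap.comp_apply, LinearMap.lTensor_tmul, LinearMap.mul'_apply,
            antipodeMap_incl_mul, antipodeMap_Phi, antipodePhi]
          induction D.coact y with
          | zero => simp
          | add a b ha hb => simp only [map_add, add_mul, mul_add, ha, hb]
          | tmul y1 y2 =>
            simp [G, mul_assoc, HopfAlgebra.antipode_mul_antidistrib]
    · simp only [LinearMap.comp_apply]
      induction D.coact h with
      | zero => simp
      | add a b ha hb => simp only [map_add, ha, hb]
      | tmul g n => simp [G, Algebra.algebraMap_eq_smul_one]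
  apply LinearMap.ext
  intro x
  induction x using induction with
  | zero => simp
  | add x y hx hy => simp only [map_add, hx, hy]
  | tmul m h =>
    refine Eq.trans (congrArg Q (comul_tm D m h)) (Eq.trans ?_
      (congrArg (algebraMap k (Bicross D)) (counit_tm D m h)).symm)
    have e1 : ∀ t u, Q (Algebra.TensorProduct.map (incl D) (incl D) t * u) =
        LinearMap.mul' k _ (TensorProduct.map (LinearMap.mulRight k (Q u) ∘ₗ (incl D).toLinearMap)
          ((incl D).toLinearMap ∘ₗ HopfAlgebra.antipode k) t) := by
      intro t u
      induction t with
      | zero => simp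
      | add a b ha hb => simp only [map_add, add_mul, ha, hb]
      | tmul a b =>
        induction u with
        | zero => simp
        | add c d ha hb =>
          simp only [TensorProduct.map_tmul, LinearMap.comp_apply, LinearMap.mul'_apply,
            LinearMap.mulRight_apply, map_add, mul_add, add_mul] at ha hb ⊢
          rw [ha, hb]
        | tmul p q => simp [Q, antipodeMap_incl_mul, mul_assoc]
    have key := congrArg (incl D) (HopfAlgebra.mul_antipode_lTensor_comul_apply (R := k) m)
    have e2 : Q (comulIncl D m * comulPhi D h) = incl D (LinearMap.mul' k M
        ((HopfAlgebra.antipode k).lTensor M (Coalgebra.comul m))) *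
          algebraMap k _ (Coalgebra.counit h) := by
      rw [comulIncl, AlgHom.comp_apply, e1, h3, Bialgebra.comulAlgHom_apply]
      induction Coalgebra.comul (R := k) m with
      | zero => simp
      | add a b ha hb => simp only [map_add, add_mul, ha, hb]
      | tmul a b => simp [Algebra.algebraMap_eq_smul_one]
    rw [e2, key]
    simp

instance : HopfAlgebra k (Bicross D) where
  antipode := antipodeMap D
  mul_antipode_rTensor_comul := antipode_left_aux D
  mul_antipode_lTensor_comul := antipode_right_aux D

/-- The projection `π(m ⊗ h) = ε(m) h` of `M ▶◁ H` onto `H`. -/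
def proj : Bicross D →ₗ[k] H :=
  (TensorProduct.lid k H).toLinearMap ∘ₗ
    (Coalgebra.counit (R := k) (A := M)).rTensor H ∘ₗ (of D).symm.toLinearMap

/-- The right coaction `Δ_R = (id ⊗ π) ∘ Δ` of `H` on `M ▶◁ H`. -/
def deltaR : Bicross D →ₗ[k] Bicross D ⊗[k] H :=
  (proj D).lTensor (Bicross D) ∘ₗ Coalgebra.comul

end Bicross

section Calculus

variable (k A : Type*) [Field k] [Ring A]

/-- The universal one-forms `Ω¹A = ker(μ : A ⊗ A → A)`. The `A`-bimodule structure of `A ⊗ A` is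
`a · x · b = (a ⊗ 1) x (1 ⊗ b)`, with the product of the algebra `A ⊗ A`. -/
def Omega [Algebra k A] : Submodule k (A ⊗[k] A) := LinearMap.ker (LinearMap.mul' k A)

/-- `a ↦ a ⊗ 1` -/
def inl [Algebra k A] : A →ₗ[k] A ⊗[k] A :=
  (Algebra.TensorProduct.includeLeft : A →ₐ[k] A ⊗[k] A).toLinearMap

/-- `a ↦ 1 ⊗ a` -/
def inr [Algebra k A] : A →ₗ[k] A ⊗[k] A :=
  (Algebra.TensorProduct.includeRight : A →ₐ[k] A ⊗[k] A).toLinearMap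

/-- The universal differential `d_U a = 1 ⊗ a - a ⊗ 1`. -/
def dU [Algebra k A] : A →ₗ[k] A ⊗[k] A := inr k A - inl k A

theorem mul'_inl_mul [Algebra k A] (a : A) (x : A ⊗[k] A) :
    LinearMap.mul' k A (inl k A a * x) = a * LinearMap.mul' k A x := by
  induction x with
  | zero => simp
  | add x y hx hy => simp only [mul_add, map_add, hx, hy]
  | tmul b c => simp [inl, mul_assoc]

theorem mul'_mul_inr [Algebra k A] (a : A) (x : A ⊗[k] A) :
    LinearMap.mul' k A (x * inr k A a) = LinearMap.mul' k A x * a := by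
  induction x with
  | zero => simp
  | add x y hx hy => simp only [add_mul, map_add, hx, hy]
  | tmul b c => simp [inr, mul_assoc]

theorem mul'_dU [Algebra k A] (a : A) : LinearMap.mul' k A (dU k A a) = 0 := by
  simp [dU, inl, inr]

/-- The augmentation ideal `ker ε`. -/
abbrev kerEps [HopfAlgebra k A] : Submodule k A :=
  LinearMap.ker (Coalgebra.counit (R := k) (A := A))

/-- `π_ε(a) = a - ε(a) 1` -/
def piEps [HopfAlgebra k A] : A →ₗ[k] kerEps k A :=
  LinearMap.codRestrict (kerEps k A)
    (LinearMap.id - Algebra.linearMap k A ∘ₗ Coalgebra.counit) (by intro a; simp)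

theorem mul'_conv_inl {k A C : Type*} [Field k] [Ring A] [Algebra k A] [AddCommGroup C]
    [Module k C] [Coalgebra k C] (f : C →ₗ[k] A) (g : C →ₗ[k] A ⊗[k] A)
    (hg : ∀ c, LinearMap.mul' k A (g c) = 0) (c : C) :
    LinearMap.mul' k A (conv (inl k A ∘ₗ f) g c) = 0 := by
  rw [conv_apply]
  induction Coalgebra.comul (R := k) c with
  | zero => simp
  | add x y hx hy => simp only [map_add, hx, hy, add_zero]
  | tmul a b => simp [mul'_inl_mul, hg]

theorem mul'_conv_inr {k A C : Type*} [Field k] [Ring A] [Algebra k A] [AddCommGroup C]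
    [Module k C] [Coalgebra k C] (f : C →ₗ[k] A) (g : C →ₗ[k] A ⊗[k] A)
    (hg : ∀ c, LinearMap.mul' k A (g c) = 0) (c : C) :
    LinearMap.mul' k A (conv g (inr k A ∘ₗ f) c) = 0 := by
  rw [conv_apply]
  induction Coalgebra.comul (R := k) c with
  | zero => simp
  | add x y hx hy => simp only [map_add, hx, hy, add_zero]
  | tmul a b => simp [mul'_mul_inr, hg]

/-- `a ↦ S(a₁) d_U(a₂)` -/
def maurerCartan [HopfAlgebra k A] : A →ₗ[k] Omega k A :=
  LinearMap.codRestrict (Omega k A) (conv (inl k A ∘ₗ HopfAlgebra.antipode k) (dU k A))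
    (mul'_conv_inl _ _ (mul'_dU k A))

/-- The left regular coaction `Δ_L(u ⊗ v) = u₁ v₁ ⊗ (u₂ ⊗ v₂)` on `A ⊗ A`. -/
def deltaL [HopfAlgebra k A] : A ⊗[k] A →ₗ[k] A ⊗[k] (A ⊗[k] A) :=
  (LinearMap.mul' k A).rTensor (A ⊗[k] A) ∘ₗ Coalgebra.comul

/-- The right adjoint coaction `Ad(a) = a₂ ⊗ S(a₁) a₃`. -/
def Ad [HopfAlgebra k A] : A →ₗ[k] A ⊗[k] A :=
  (LinearMap.mul' k A ∘ₗ (HopfAlgebra.antipode k).rTensor A).lTensor A ∘ₗ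
    (TensorProduct.leftComm k A A A).toLinearMap ∘ₗ
    (Coalgebra.comul (R := k) (A := A)).lTensor A ∘ₗ Coalgebra.comul

/-- The restriction of `Ad` to a map `ker ε → ker ε ⊗ A` (`π_ε` is the identity on `ker ε`, and `Ad`
maps `ker ε` to `ker ε ⊗ A`). -/
def AdKer [HopfAlgebra k A] : kerEps k A →ₗ[k] kerEps k A ⊗[k] A :=
  (piEps k A).rTensor A ∘ₗ Ad k A ∘ₗ (kerEps k A).subtype

variable {k A}

/-- A map with values in universal one-forms is left-invariant if `Δ_L(f(v)) = 1 ⊗ f(v)`. -/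
def IsLeftInvariant [HopfAlgebra k A] {V : Type*} [AddCommGroup V] [Module k V]
    (f : V →ₗ[k] Omega k A) : Prop :=
  ∀ v, deltaL k A (f v) = (1 : A) ⊗ₜ[k] (f v : A ⊗[k] A)

end Calculus

section Bundle

variable {k P H : Type*} [Field k] [Ring P] [Algebra k P] [Ring H] [HopfAlgebra k H]
  (δ : P →ₗ[k] P ⊗[k] H)

/-- `χ(u ⊗ v) = u δ(v)` -/
def chi : P ⊗[k] P →ₗ[k] P ⊗[k] H :=
  (LinearMap.mul' k P).rTensor H ∘ₗ (TensorProduct.assoc k P P H).symm.toLinearMap ∘ₗ δ.lTensor P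

/-- The tensor product coaction `u ⊗ v ↦ (u₍₀₎ ⊗ v₍₀₎) ⊗ u₍₁₎ v₍₁₎` on `P ⊗ P`, where
`δ(u) = u₍₀₎ ⊗ u₍₁₎`. -/
def deltaR₂ : P ⊗[k] P →ₗ[k] (P ⊗[k] P) ⊗[k] H :=
  (LinearMap.mul' k H).lTensor (P ⊗[k] P) ∘ₗ
    (TensorProduct.tensorTensorTensorComm k P H P H).toLinearMap ∘ₗ TensorProduct.map δ δ

/-- The base `{u | δ(u) = u ⊗ 1}`. -/
def base : Submodule k P := LinearMap.eqLocus δ ((TensorProduct.mk k P H).flip 1)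

/-- The universal one-forms on the base, inside `P ⊗ P`. -/
def baseOmega : Submodule k (P ⊗[k] P) :=
  Omega k P ⊓ LinearMap.range (TensorProduct.mapIncl (base δ) (base δ))

/-- `(Ω¹B) P` for the base `B`. -/
def baseOmegaMul : Submodule k (P ⊗[k] P) :=
  Submodule.span k {y | ∃ x ∈ baseOmega δ, ∃ p : P, y = x * inr k P p}

/-- A connection on a bundle with universal calculus: `χ ∘ ω = 1 ⊗ id` and
`Δ_R ∘ ω = (ω ⊗ id) ∘ Ad`. -/
def IsConnection (ω : kerEps k H →ₗ[k] Omega k P) : Prop :=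
  (∀ h, chi δ (ω h) = (1 : P) ⊗ₜ[k] (h : H)) ∧
  (∀ h, deltaR₂ δ (ω h) = ((Omega k P).subtype ∘ₗ ω).rTensor H (AdKer k H h))

/-- The projection `Π = · ∘ (id ⊗ ω) ∘ χ` of a connection, that is
`Π(u d_U v) = u v₍₀₎ ω(π_ε(v₍₁₎))`. It is the projection on `Ω¹P`, where `χ` takes values in
`P ⊗ ker ε`. -/
def connProj (ω : kerEps k H →ₗ[k] Omega k P) : P ⊗[k] P →ₗ[k] P ⊗[k] P :=
  LinearMap.mul' k (P ⊗[k] P) ∘ₗ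
    TensorProduct.map (inl k P) ((Omega k P).subtype ∘ₗ ω ∘ₗ piEps k H) ∘ₗ chi δ

/-- A connection is strong if `(id - Π)(d_U P) ⊆ (Ω¹B) P` for the base `B`. -/
def IsStrong (ω : kerEps k H →ₗ[k] Omega k P) : Prop :=
  ∀ u, dU k P u - connProj δ ω (dU k P u) ∈ baseOmegaMul δ

end Bundle

section Splitting

variable {k P H : Type*} [Field k] [Ring P] [HopfAlgebra k P] [Ring H] [HopfAlgebra k H]

/-- A splitting of `π : P → H`: `π ∘ i = id` and `(id ⊗ π) ∘ Ad ∘ i = (i ⊗ id) ∘ Ad`. -/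
def IsSplitting (π : P →ₗ[k] H) (i : kerEps k H →ₗ[k] kerEps k P) : Prop :=
  (∀ h, π (i h) = h) ∧
  (∀ h, π.lTensor P (Ad k P (i h)) =
    ((kerEps k P).subtype ∘ₗ i).rTensor H (AdKer k H h))

/-- The canonical connection `h ↦ S(i(h)₁) d_U(i(h)₂)` of a splitting `i`. -/
def canonicalConnection (i : kerEps k H →ₗ[k] kerEps k P) : kerEps k H →ₗ[k] Omega k P :=
  maurerCartan k P ∘ₗ (kerEps k P).subtype ∘ₗ i

end Splitting

section Main

variable {k M H : Type*} [Field k] [Ring M] [Ring H] [HopfAlgebra k M] [HopfAlgebra k H]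

namespace Bicross

variable (D : MatchedPair k M H)

/-- `β_U ∘ π_ε`, with `Ω¹M` regarded inside `(M ▶◁ H) ⊗ (M ▶◁ H)`. -/
def betaP (β : kerEps k H →ₗ[k] Omega k M) : H →ₗ[k] Bicross D ⊗[k] Bicross D :=
  TensorProduct.map (incl D).toLinearMap (incl D).toLinearMap ∘ₗ (Omega k M).subtype ∘ₗ
    β ∘ₗ piEps k H

theorem mul'_betaP (β : kerEps k H →ₗ[k] Omega k M) (h : H) :
    LinearMap.mul' k (Bicross D) (betaP D β h) = 0 := by
  have h1 : ∀ x : M ⊗[k] M, LinearMap.mul' k (Bicross D)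
      (TensorProduct.map (incl D).toLinearMap (incl D).toLinearMap x) =
        incl D (LinearMap.mul' k M x) := by
    intro x
    induction x with
    | zero => simp
    | add x y hx hy => simp only [map_add, hx, hy]
    | tmul a b => simp
  have h2 : LinearMap.mul' k M (β (piEps k H h)) = 0 := (β (piEps k H h)).2
  simp [betaP, h1, h2]

/-- The connection `ω_U(h) = Φ⁻¹(h₁) β_U(π_ε(h₂)) Φ(h₃) + Φ⁻¹(h₁) d_U Φ(h₂)` on the trivial bundle
`M ▶◁ H`, where `Φ⁻¹ = Φ ∘ S`. -/
def connectionOfBeta (β : kerEps k H →ₗ[k] Omega k M) :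
    kerEps k H →ₗ[k] Omega k (Bicross D) :=
  LinearMap.codRestrict (Omega k (Bicross D))
    (conv (inl k (Bicross D) ∘ₗ (Phi D).toLinearMap ∘ₗ HopfAlgebra.antipode k)
        (conv (betaP D β) (inr k (Bicross D) ∘ₗ (Phi D).toLinearMap)) +
      conv (inl k (Bicross D) ∘ₗ (Phi D).toLinearMap ∘ₗ HopfAlgebra.antipode k)
        (dU k (Bicross D) ∘ₗ (Phi D).toLinearMap)) (by
      intro h
      have h1 := mul'_conv_inl ((Phi D).toLinearMap ∘ₗ HopfAlgebra.antipode k) _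
        (mul'_conv_inr (Phi D).toLinearMap _ (mul'_betaP D β)) h
      have h2 := mul'_conv_inl ((Phi D).toLinearMap ∘ₗ HopfAlgebra.antipode k)
        (dU k (Bicross D) ∘ₗ (Phi D).toLinearMap) (fun c => mul'_dU k _ _) h
      rw [Omega, LinearMap.mem_ker, LinearMap.add_apply, map_add, h1, h2, add_zero]) ∘ₗ
    (kerEps k H).subtype

/-- The compatibility of `β_U` with the coaction,
`β_U(π_ε(h₁)) h₂⁽²⁾ ⊗ h₂⁽¹⁾ - h₁⁽²⁾ β_U(π_ε(h₂)) ⊗ h₁⁽¹⁾ = - d_U h⁽²⁾ ⊗ h⁽¹⁾` for all `h`, an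
equation in `(M ⊗ M) ⊗ H`, in which the two terms on the left are convolution products. -/
def BetaCompatible (β : kerEps k H →ₗ[k] Omega k M) : Prop :=
  let b : H →ₗ[k] (M ⊗[k] M) ⊗[k] H :=
    (Algebra.TensorProduct.includeLeft : M ⊗[k] M →ₐ[k] (M ⊗[k] M) ⊗[k] H).toLinearMap ∘ₗ
      (Omega k M).subtype ∘ₗ β ∘ₗ piEps k H
  let c : H →ₗ[k] M ⊗[k] H := (TensorProduct.comm k H M).toLinearMap ∘ₗ D.coact
  conv b ((inr k M).rTensor H ∘ₗ c) - conv ((inl k M).rTensor H ∘ₗ c) b =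
    -((dU k M).rTensor H ∘ₗ c)

/-- The compatibility of `γ` with the coaction,
`γ(h₁) h₂⁽²⁾ ⊗ h₂⁽¹⁾ = γ(h₂) ⊗ h₁` for all `h`. -/
def GammaCompatible (γ : H →ₗ[k] M) : Prop :=
  conv ((Algebra.TensorProduct.includeLeft : M →ₐ[k] M ⊗[k] H).toLinearMap ∘ₗ γ)
      ((TensorProduct.comm k H M).toLinearMap ∘ₗ D.coact) =
    γ.rTensor H ∘ₗ (TensorProduct.comm k H H).toLinearMap ∘ₗ Coalgebra.comul

/-- The strong left-invariant connections on `M ▶◁ H`. -/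
def strongInvariantConnections : Set (kerEps k H →ₗ[k] Omega k (Bicross D)) :=
  {ω | IsConnection (deltaR D) ω ∧ IsStrong (deltaR D) ω ∧ IsLeftInvariant ω}

/-- The left-invariant maps `β_U : ker ε → Ω¹M` that are compatible with the coaction. -/
def admissibleBetas : Set (kerEps k H →ₗ[k] Omega k M) :=
  {β | IsLeftInvariant β ∧ BetaCompatible D β}

/-- The linear maps `γ : H → M` with `γ(1) = 1` and `ε ∘ γ = ε` that are compatible with the
coaction. -/
def admissibleGammas : Set (H →ₗ[k] M) :=
  {γ | γ 1 = 1 ∧ (∀ h, Coalgebra.counit (R := k) (γ h) = Coalgebra.counit (R := k) h) ∧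
    GammaCompatible D γ}

/-- `β_U(h) = S(γ(h)₁) d_U(γ(h)₂)` for `h ∈ ker ε` -/
def betaOfGamma (γ : H →ₗ[k] M) : kerEps k H →ₗ[k] Omega k M :=
  maurerCartan k M ∘ₗ γ ∘ₗ (kerEps k H).subtype

/-- `i(h) = γ(h₁) ⊗ h₂` -/
def splittingOfGamma (γ : H →ₗ[k] M) : H →ₗ[k] Bicross D :=
  (of D).toLinearMap ∘ₗ γ.rTensor H ∘ₗ Coalgebra.comul

end Bicross

end Main

end QPB

end

/-!
Extend a map `f` from `ker ε` to one-forms to `F(h) = f(π_ε(h)) + ε(h) 1`. The connection attached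
to `β` then satisfies `ω + ε = Φ⁻¹ * (β + ε) * Φ` in the convolution algebra of maps `H → P ⊗ P`,
and the conditions on `ω`, `β` and `γ` become homogeneous identities between such products.

Conjugation by `Φ` turns the `Ad`-equivariance of `ω + ε` into coinvariance of the values of
`B = Φ * (ω + ε) * Φ⁻¹`. Strongness says that `B` has values in `M ⊗ P`, hence, with coinvariance,
in `M ⊗ M`. In the coproduct `Δ Φ(h) = Φ(h₁⁽¹⁾) ⊗ h₁⁽²⁾ Φ(h₂)` the factor `1 ⊗ Φ(h₂)` cancels from
the left-invariance of `ω`, and `m ⊗ h ↦ m ε(h)` on the first tensor factor separates what is left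
into the left-invariance of `β` and its compatibility with the coaction.

The left-invariant elements of `A ⊗ A` are exactly the `S(a₁) ⊗ a₂`, where `a` is recovered by
applying `ε ⊗ id`. So `β + ε` and `ω + ε` correspond to maps `γ : H → M` and `i : H → P`, and
applying `ε ⊗ id` to `ω + ε = Φ⁻¹ * (β + ε) * Φ` gives `i = γ * Φ`.
-/

noncomputable section

namespace QPB

open Algebra.TensorProduct (includeLeft includeRight)

section Convolution

variable {k C A B : Type*} [CommSemiring k] [AddCommMonoid C] [Module k C] [Coalgebra k C]

section Semiring

variable [Semiring A] [Algebra k A] [Semiring B] [Algebra k B]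

variable (k C A) in
/-- The unit `c ↦ ε(c) 1` of the convolution product. -/
def convUnit : C →ₗ[k] A := Algebra.linearMap k A ∘ₗ Coalgebra.counit

theorem convUnit_apply (c : C) : convUnit k C A c = algebraMap k A (Coalgebra.counit c) := rfl

theorem conv_convUnit (f : C →ₗ[k] A) : conv f (convUnit k C A) = f :=
  congrArg WithConv.ofConv (mul_one (WithConv.toConv f))

theorem convUnit_conv (f : C →ₗ[k] A) : conv (convUnit k C A) f = f :=
  congrArg WithConv.ofConv (one_mul (WithConv.toConv f))

theorem conv_add (f g h : C →ₗ[k] A) : conv f (g + h) = conv f g + conv f h :=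
  congrArg WithConv.ofConv
    (mul_add (WithConv.toConv f) (WithConv.toConv g) (WithConv.toConv h))

theorem add_conv (f g h : C →ₗ[k] A) : conv (f + g) h = conv f h + conv g h :=
  congrArg WithConv.ofConv
    (add_mul (WithConv.toConv f) (WithConv.toConv g) (WithConv.toConv h))

theorem algHom_comp_convUnit (φ : A →ₐ[k] B) :
    φ.toLinearMap ∘ₗ convUnit k C A = convUnit k C B := by
  ext c
  simp [convUnit]

theorem comp_comul_eq_conv {T : C ⊗[k] C →ₗ[k] A} {f g : C →ₗ[k] A}
    (h : ∀ c d, T (c ⊗ₜ d) = f c * g d) : T ∘ₗ Coalgebra.comul = conv f g := by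
  have hT : T = LinearMap.mul' k A ∘ₗ TensorProduct.map f g := TensorProduct.ext' fun c d => by
    rw [h, LinearMap.comp_apply, TensorProduct.map_tmul, LinearMap.mul'_apply]
  rw [hT]
  rfl

theorem comp_conv_eq_conv {Ψ : A →ₗ[k] B} {f g : C →ₗ[k] A} {f' g' : C →ₗ[k] B}
    (h : ∀ c d, Ψ (f c * g d) = f' c * g' d) : Ψ ∘ₗ conv f g = conv f' g' :=
  comp_comul_eq_conv (T := Ψ ∘ₗ LinearMap.mul' k A ∘ₗ TensorProduct.map f g) h

theorem conv_mem {S : Submodule k A} {f g : C →ₗ[k] A} (h : ∀ c d, f c * g d ∈ S) (c : C) :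
    conv f g c ∈ S := by
  rw [conv_apply]
  induction Coalgebra.comul (R := k) c with
  | zero => simp
  | add x y hx hy =>
    rw [map_add, map_add]
    exact add_mem hx hy
  | tmul x y => exact h x y

theorem conv_right_cancel {f f' g h : C →ₗ[k] A} (hf : conv f f' = convUnit k C A)
    (e : conv g f = conv h f) : g = h := by
  rw [← conv_convUnit g, ← conv_convUnit h, ← hf, ← conv_assoc, ← conv_assoc, e]

end Semiring

section Ring

variable [Ring A] [Algebra k A]

theorem conv_sub (f g h : C →ₗ[k] A) : conv f (g - h) = conv f g - conv f h :=
  congrArg WithConv.ofConv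
    (mul_sub (WithConv.toConv f) (WithConv.toConv g) (WithConv.toConv h))

theorem sub_conv (f g h : C →ₗ[k] A) : conv (f - g) h = conv f h - conv g h :=
  congrArg WithConv.ofConv
    (sub_mul (WithConv.toConv f) (WithConv.toConv g) (WithConv.toConv h))

end Ring

end Convolution

section Bialgebra

variable {k A X : Type*} [CommSemiring k] [Semiring A] [Bialgebra k A] [Semiring X] [Algebra k X]

theorem conv_one_apply (f g : A →ₗ[k] X) : conv f g 1 = f 1 * g 1 := by
  rw [conv_apply, Bialgebra.comul_one, Algebra.TensorProduct.one_def, TensorProduct.map_tmul,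
    LinearMap.mul'_apply]

/-- `a ↦ a₁ ⊗ j(a₂)`. With the two inclusions `A → A ⊗ A` for `j` it describes `Δ_L` on the
generators `a ⊗ 1` and `1 ⊗ a` of `A ⊗ A`. -/
def pushComul (j : A →ₐ[k] X) : A →ₐ[k] A ⊗[k] X :=
  (Algebra.TensorProduct.map (.id k A) j).comp (Bialgebra.comulAlgHom k A)

theorem pushComul_eq_conv (j : A →ₐ[k] X) : (pushComul j).toLinearMap =
    conv (includeLeft : A →ₐ[k] A ⊗[k] X).toLinearMap
      ((includeRight : X →ₐ[k] A ⊗[k] X).comp j).toLinearMap :=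
  comp_comul_eq_conv (T := (Algebra.TensorProduct.map (.id k A) j).toLinearMap) fun c d => by
    simp

variable (k A X) in
/-- The algebra map `u ⊗ x ↦ ε(u) x`. -/
def counitLeft : A ⊗[k] X →ₐ[k] X :=
  (Algebra.TensorProduct.lid k X).toAlgHom.comp
    (Algebra.TensorProduct.map (Bialgebra.counitAlgHom k A) (.id k X))

theorem counitLeft_tmul (a : A) (x : X) :
    counitLeft k A X (a ⊗ₜ x) = Coalgebra.counit (R := k) a • x := by
  simp [counitLeft]

theorem counitLeft_comp_includeRight :
    (counitLeft k A X).comp (includeRight : X →ₐ[k] A ⊗[k] X) = .id k X := by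
  ext x
  simp [counitLeft_tmul]

theorem counit_counitLeft (x : A ⊗[k] A) :
    Coalgebra.counit (R := k) (counitLeft k A A x) =
      Coalgebra.counit (R := k) (LinearMap.mul' k A x) := by
  induction x with
  | zero => simp
  | add x y hx hy => simp only [map_add, hx, hy]
  | tmul a b => simp [counitLeft_tmul]

end Bialgebra

section Conjugation

variable {k H A A' B : Type*} [CommSemiring k] [Semiring H] [HopfAlgebra k H] [Semiring A]
  [Algebra k A] [Semiring A'] [Algebra k A'] [Semiring B] [Algebra k B]

theorem conv_antipode (φ : H →ₐ[k] A) :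
    conv φ.toLinearMap (φ.toLinearMap ∘ₗ HopfAlgebra.antipode k) = convUnit k H A := by
  have h : conv LinearMap.id (HopfAlgebra.antipode k) = convUnit k H H :=
    congrArg WithConv.ofConv (LinearMap.id_mul_antipode (R := k) (C := H))
  rw [← algHom_comp_convUnit φ, ← h, algHom_comp_conv, LinearMap.comp_id]

theorem antipode_conv (φ : H →ₐ[k] A) :
    conv (φ.toLinearMap ∘ₗ HopfAlgebra.antipode k) φ.toLinearMap = convUnit k H A := by
  have h : conv (HopfAlgebra.antipode k) LinearMap.id = convUnit k H H :=
    congrArg WithConv.ofConv (LinearMap.antipode_mul_id (R := k) (C := H))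
  rw [← algHom_comp_convUnit φ, ← h, algHom_comp_conv, LinearMap.comp_id]

/-- The two-sided convolution `u⁻¹ * f * v` with algebra maps `u` and `v` on a Hopf algebra, where
`u⁻¹ = u ∘ S`: a gauge transformation when `u` and `v` are the left and right actions of a
trivialisation. -/
def conj (u v : H →ₐ[k] A) (f : H →ₗ[k] A) : H →ₗ[k] A :=
  conv (u.toLinearMap ∘ₗ HopfAlgebra.antipode k) (conv f v.toLinearMap)

theorem conv_conj (u v : H →ₐ[k] A) (f : H →ₗ[k] A) :
    conv u.toLinearMap (conj u v f) = conv f v.toLinearMap := by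
  rw [conj, ← conv_assoc, conv_antipode, convUnit_conv]

theorem conj_eq_iff (u v : H →ₐ[k] A) (f g : H →ₗ[k] A) :
    conj u v f = g ↔ conv f v.toLinearMap = conv u.toLinearMap g := by
  refine ⟨fun h => h ▸ (conv_conj u v f).symm, fun h => ?_⟩
  rw [conj, h, ← conv_assoc, antipode_conv, convUnit_conv]

theorem conj_injective (u v : H →ₐ[k] A) : Function.Injective (conj u v) := fun f g h =>
  conv_right_cancel (conv_antipode v) (by rw [← conv_conj, h, conv_conj])

theorem conj_surjective (u v : H →ₐ[k] A) : Function.Surjective (conj u v) := fun g =>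
  ⟨conv (conv u.toLinearMap g) (v.toLinearMap ∘ₗ HopfAlgebra.antipode k), by
    rw [conj_eq_iff, conv_assoc, antipode_conv, conv_convUnit]⟩

theorem conj_apply_one (u v : H →ₐ[k] A) (f : H →ₗ[k] A) : conj u v f 1 = f 1 := by
  rw [conj, conv_one_apply, conv_one_apply, LinearMap.comp_apply, HopfAlgebra.antipode_one]
  simp only [AlgHom.toLinearMap_apply, map_one, one_mul, mul_one]

theorem conj_self_convUnit (u : H →ₐ[k] A) : conj u u (convUnit k H A) = convUnit k H A := by
  rw [conj_eq_iff, convUnit_conv, conv_convUnit]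

theorem comp_conj {Ψ : A →ₗ[k] B} {u v : H →ₐ[k] A} {u' v' : H →ₐ[k] B} (f : H →ₗ[k] A)
    (h : ∀ c x d, Ψ (u c * (x * v d)) = u' c * (Ψ x * v' d)) :
    Ψ ∘ₗ conj u v f = conj u' v' (Ψ ∘ₗ f) := by
  refine comp_conv_eq_conv fun c d => ?_
  have hc : Ψ ∘ₗ LinearMap.mulLeft k (u (HopfAlgebra.antipode k c)) ∘ₗ conv f v.toLinearMap =
      LinearMap.mulLeft k (u' (HopfAlgebra.antipode k c)) ∘ₗ
        conv (Ψ ∘ₗ f) v'.toLinearMap := by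
    rw [mulLeft_comp_conv, mulLeft_comp_conv]
    exact comp_conv_eq_conv fun a b => by
      simpa only [LinearMap.comp_apply, LinearMap.mulLeft_apply, AlgHom.toLinearMap_apply,
        mul_assoc] using h (HopfAlgebra.antipode k c) (f a) b
  exact LinearMap.congr_fun hc d

theorem algHom_comp_conj (φ : A →ₐ[k] B) (u v : H →ₐ[k] A) (f : H →ₗ[k] A) :
    φ.toLinearMap ∘ₗ conj u v f = conj (φ.comp u) (φ.comp v) (φ.toLinearMap ∘ₗ f) :=
  comp_conj f fun c x d => by
    simp only [AlgHom.toLinearMap_apply, AlgHom.comp_apply, map_mul]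

theorem map_includeLeft_mul_mul_includeRight {Ψ : A ⊗[k] A' →ₗ[k] B} {l : A →ₐ[k] B}
    {r : A' →ₐ[k] B} (h : ∀ a b, Ψ (a ⊗ₜ b) = l a * r b) (a : A) (x : A ⊗[k] A') (b : A') :
    Ψ (includeLeft (S := k) a * (x * includeRight b)) = l a * (Ψ x * r b) := by
  induction x with
  | zero => simp
  | add x y hx hy => simp only [add_mul, mul_add, map_add, hx, hy]
  | tmul c d => simp [h, mul_assoc]

theorem map_one_of_map_tmul {Ψ : A ⊗[k] A' →ₗ[k] B} {l : A →ₐ[k] B} {r : A' →ₐ[k] B}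
    (h : ∀ a b, Ψ (a ⊗ₜ b) = l a * r b) : Ψ 1 = 1 := by
  rw [Algebra.TensorProduct.one_def, h, map_one, map_one, one_mul]

theorem comp_convUnit_of_map_tmul {Ψ : A ⊗[k] A' →ₗ[k] B} {l : A →ₐ[k] B} {r : A' →ₐ[k] B}
    (h : ∀ a b, Ψ (a ⊗ₜ b) = l a * r b) :
    Ψ ∘ₗ convUnit k H (A ⊗[k] A') = convUnit k H B := by
  ext c
  rw [LinearMap.comp_apply, convUnit_apply, convUnit_apply, Algebra.algebraMap_eq_smul_one,
    map_smul, map_one_of_map_tmul h, Algebra.algebraMap_eq_smul_one]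

theorem comp_conj_includeLeft_includeRight {Ψ : A ⊗[k] A' →ₗ[k] B} {l : A →ₐ[k] B}
    {r : A' →ₐ[k] B} (h : ∀ a b, Ψ (a ⊗ₜ b) = l a * r b) (u : H →ₐ[k] A) (v : H →ₐ[k] A')
    (f : H →ₗ[k] A ⊗[k] A') :
    Ψ ∘ₗ conj (includeLeft.comp u) (includeRight.comp v) f =
      conj (l.comp u) (r.comp v) (Ψ ∘ₗ f) :=
  comp_conj f fun c x d => map_includeLeft_mul_mul_includeRight h (u c) x (v d)

theorem conj_eq_conj_iff {u v l r : H →ₐ[k] A} {u₀ v₀ : H →ₗ[k] A}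
    (hu : u.toLinearMap = conv u₀ l.toLinearMap) (hv : v.toLinearMap = conv v₀ r.toLinearMap)
    (f g : H →ₗ[k] A) : conj u v f = conj l r g ↔ conv f v₀ = conv u₀ g := by
  rw [conj_eq_iff, hu, hv, conv_assoc, conv_conj, ← conv_assoc, ← conv_assoc]
  exact ⟨conv_right_cancel (conv_antipode r), fun h => by rw [h]⟩

end Conjugation

section Forms

variable {k A B : Type*} [Field k] [Ring A] [Ring B]

theorem inl_apply [Algebra k A] (a : A) : inl k A a = a ⊗ₜ 1 := rfl

theorem inr_apply [Algebra k A] (a : A) : inr k A a = 1 ⊗ₜ a := rfl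

variable [HopfAlgebra k A]

theorem piEps_coe (a : A) : (piEps k A a : A) = a - algebraMap k A (Coalgebra.counit a) := rfl

theorem counit_coe_kerEps (a : kerEps k A) : Coalgebra.counit (R := k) (a : A) = 0 := a.2

theorem piEps_of_mem (a : kerEps k A) : piEps k A a = a :=
  Subtype.ext <| by rw [piEps_coe, counit_coe_kerEps, map_zero, sub_zero]

theorem piEps_one : piEps k A 1 = 0 :=
  Subtype.ext <| by simp [piEps_coe]

theorem ext_one_kerEps {X : Type*} [AddCommGroup X] [Module k X] {F G : A →ₗ[k] X}
    (h1 : F 1 = G 1) (h : ∀ a : kerEps k A, F a = G a) : F = G := by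
  ext a
  have ha : a = (piEps k A a : A) + Coalgebra.counit (R := k) a • (1 : A) := by
    rw [piEps_coe, Algebra.algebraMap_eq_smul_one, sub_add_cancel]
  rw [ha, map_add, map_add, map_smul, map_smul, h1, h]

theorem comp_piEps {X : Type*} [Ring X] [Algebra k X] {F : A →ₗ[k] X} (hF : F 1 = 1) :
    F ∘ₗ (kerEps k A).subtype ∘ₗ piEps k A = F - convUnit k A X := by
  ext a
  change F (piEps k A a) = F a - convUnit k A X a
  rw [piEps_coe, map_sub, Algebra.algebraMap_eq_smul_one, map_smul, hF, convUnit_apply,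
    Algebra.algebraMap_eq_smul_one]

variable [Algebra k B]

/-- A linear map on `ker ε` with values in one-forms, extended to `h ↦ f(π_ε(h)) + ε(h) 1`. For the
extended maps the conditions on `f` become homogeneous in the convolution algebra. -/
def extendUnit (f : kerEps k A →ₗ[k] Omega k B) : A →ₗ[k] B ⊗[k] B :=
  (Omega k B).subtype ∘ₗ f ∘ₗ piEps k A + convUnit k A (B ⊗[k] B)

theorem extendUnit_apply (f : kerEps k A →ₗ[k] Omega k B) (a : A) :
    extendUnit f a = f (piEps k A a) + convUnit k A (B ⊗[k] B) a := rfl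

theorem extendUnit_coe (f : kerEps k A →ₗ[k] Omega k B) (a : kerEps k A) :
    extendUnit f a = f a := by
  rw [extendUnit_apply, piEps_of_mem, convUnit_apply, counit_coe_kerEps, map_zero, add_zero]

theorem extendUnit_one (f : kerEps k A →ₗ[k] Omega k B) : extendUnit f 1 = 1 := by
  rw [extendUnit_apply, piEps_one, map_zero, convUnit_apply, Bialgebra.counit_one, map_one,
    ZeroMemClass.coe_zero, zero_add]

theorem mul'_comp_extendUnit (f : kerEps k A →ₗ[k] Omega k B) :
    LinearMap.mul' k B ∘ₗ extendUnit f = convUnit k A B := by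
  have hf : LinearMap.mul' k B ∘ₗ (Omega k B).subtype = 0 := LinearMap.ext fun x => x.2
  rw [extendUnit, LinearMap.comp_add, ← LinearMap.comp_assoc, hf, LinearMap.zero_comp, zero_add]
  ext a
  simp [convUnit, Algebra.algebraMap_eq_smul_one, Algebra.TensorProduct.one_def]

theorem extendUnit_injective :
    Function.Injective (extendUnit : (kerEps k A →ₗ[k] Omega k B) → (A →ₗ[k] B ⊗[k] B)) := by
  intro f g h
  ext a
  rw [← extendUnit_coe, ← extendUnit_coe, h]

theorem extendUnit_eq {f : kerEps k A →ₗ[k] Omega k B} {F : A →ₗ[k] B ⊗[k] B} (h1 : F 1 = 1)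
    (hF : ∀ a : kerEps k A, F a = f a) : extendUnit f = F :=
  ext_one_kerEps (by rw [extendUnit_one, h1]) fun a => by rw [extendUnit_coe, hF]

theorem exists_extendUnit {F : A →ₗ[k] B ⊗[k] B} (h1 : F 1 = 1)
    (hF : ∀ a, F a - convUnit k A (B ⊗[k] B) a ∈ Omega k B) :
    ∃ f : kerEps k A →ₗ[k] Omega k B, extendUnit f = F := by
  refine ⟨LinearMap.codRestrict (Omega k B) (F ∘ₗ (kerEps k A).subtype) fun a => ?_,
    extendUnit_eq h1 fun _ => rfl⟩
  have := hF a
  rwa [convUnit_apply, counit_coe_kerEps, map_zero, sub_zero] at this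

end Forms

section LeftInvariant

variable {k A : Type*} [Field k] [Ring A] [HopfAlgebra k A]

theorem deltaL_tmul (a b : A) :
    deltaL k A (a ⊗ₜ b) = pushComul includeLeft a * pushComul includeRight b := by
  simp only [deltaL, LinearMap.comp_apply, pushComul, AlgHom.comp_apply,
    Bialgebra.comulAlgHom_apply, TensorProduct.comul_tmul]
  induction Coalgebra.comul (R := k) a with
  | zero => simp
  | add x y hx hy => simp only [TensorProduct.add_tmul, map_add, add_mul, hx, hy]
  | tmul x y =>
    induction Coalgebra.comul (R := k) b with
    | zero => simp
    | add x y hx hy => simp only [TensorProduct.tmul_add, map_add, mul_add, hx, hy]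
    | tmul z w => simp

theorem isLeftInvariant_iff {C : Type*} [Ring C] [HopfAlgebra k C]
    (f : kerEps k C →ₗ[k] Omega k A) :
    IsLeftInvariant f ↔
      deltaL k A ∘ₗ extendUnit f =
        (includeRight : A ⊗[k] A →ₐ[k] A ⊗[k] (A ⊗[k] A)).toLinearMap ∘ₗ extendUnit f := by
  have hcoe (a : kerEps k C) : (deltaL k A ∘ₗ extendUnit f) a =
      (includeRight : A ⊗[k] A →ₐ[k] A ⊗[k] (A ⊗[k] A)).toLinearMap (extendUnit f a) ↔
        deltaL k A (f a) = 1 ⊗ₜ (f a : A ⊗[k] A) := by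
    rw [LinearMap.comp_apply, extendUnit_coe]
    rfl
  refine ⟨fun h => ext_one_kerEps ?_ fun a => (hcoe a).2 (h a),
    fun h a => (hcoe a).1 (LinearMap.congr_fun h a)⟩
  rw [LinearMap.comp_apply, LinearMap.comp_apply, extendUnit_one,
    map_one_of_map_tmul deltaL_tmul, AlgHom.toLinearMap_apply, map_one]

variable (k A) in
/-- `a ↦ S(a₁) ⊗ a₂`, which parametrises the left-invariant elements of `A ⊗ A`. -/
def leftInv : A →ₗ[k] A ⊗[k] A := conv (inl k A ∘ₗ HopfAlgebra.antipode k) (inr k A)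

theorem leftInv_eq_conj :
    leftInv k A = conj includeLeft includeRight (convUnit k A (A ⊗[k] A)) := by
  rw [conj, convUnit_conv]
  rfl

theorem leftInv_one : leftInv k A 1 = 1 := by
  rw [leftInv_eq_conj, conj_apply_one, convUnit_apply, Bialgebra.counit_one, map_one]

theorem deltaL_comp_leftInv : deltaL k A ∘ₗ leftInv k A =
    (includeRight : A ⊗[k] A →ₐ[k] A ⊗[k] (A ⊗[k] A)).toLinearMap ∘ₗ leftInv k A := by
  rw [leftInv_eq_conj, comp_conj _ (map_includeLeft_mul_mul_includeRight deltaL_tmul),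
    comp_convUnit_of_map_tmul deltaL_tmul, algHom_comp_conj,
    conj_eq_conj_iff (pushComul_eq_conv _) (pushComul_eq_conv _), convUnit_conv,
    algHom_comp_convUnit, conv_convUnit]

theorem counitLeft_comp_leftInv : (counitLeft k A A).toLinearMap ∘ₗ leftInv k A = .id := by
  have hinv : (counitLeft k A A).toLinearMap ∘ₗ inl k A ∘ₗ HopfAlgebra.antipode k =
      convUnit k A A := by
    ext a
    simp [inl_apply, counitLeft_tmul, convUnit_apply, Algebra.algebraMap_eq_smul_one]
  have hid : (counitLeft k A A).toLinearMap ∘ₗ inr k A = .id :=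
    congrArg AlgHom.toLinearMap counitLeft_comp_includeRight
  rw [leftInv, algHom_comp_conv, hinv, hid, convUnit_conv]

theorem conv_inl_leftInv : conv (inl k A) (leftInv k A) = inr k A := by
  rw [leftInv_eq_conj]
  exact (conv_conj includeLeft includeRight _).trans (convUnit_conv _)

theorem map_counitLeft_deltaL_tmul (a b : A) :
    Algebra.TensorProduct.map (.id k A) (counitLeft k A A) (deltaL k A (a ⊗ₜ b)) =
      inl k A a * Coalgebra.comul b := by
  set E := Algebra.TensorProduct.map (.id k A) (counitLeft k A A)
  have hl : E.toLinearMap ∘ₗ (pushComul includeLeft).toLinearMap = inl k A := by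
    have h1 : E.toLinearMap ∘ₗ (includeLeft : A →ₐ[k] A ⊗[k] (A ⊗[k] A)).toLinearMap =
        inl k A := by
      ext a
      simp [E, inl_apply]
    have h2 : E.toLinearMap ∘ₗ ((includeRight : A ⊗[k] A →ₐ[k] A ⊗[k] (A ⊗[k] A)).comp
        includeLeft).toLinearMap = convUnit k A (A ⊗[k] A) := by
      ext a
      simp [E, counitLeft_tmul, convUnit_apply, Algebra.algebraMap_eq_smul_one,
        Algebra.TensorProduct.one_def]
    rw [pushComul_eq_conv, algHom_comp_conv, h1, h2, conv_convUnit]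
  have hr : E.comp (pushComul includeRight) = Bialgebra.comulAlgHom k A := by
    rw [pushComul, ← AlgHom.comp_assoc, ← Algebra.TensorProduct.map_comp,
      counitLeft_comp_includeRight, AlgHom.comp_id, Algebra.TensorProduct.map_id, AlgHom.id_comp]
  rw [deltaL_tmul, map_mul]
  exact congrArg₂ _ (LinearMap.congr_fun hl a) (DFunLike.congr_fun hr b)

theorem leftInv_counitLeft {x : A ⊗[k] A} (hx : deltaL k A x = 1 ⊗ₜ x) :
    leftInv k A (counitLeft k A A x) = x := by
  let E := Algebra.TensorProduct.map (.id k A) (counitLeft k A A)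
  let κ : A ⊗[k] A →ₗ[k] A ⊗[k] A :=
    LinearMap.mul' k (A ⊗[k] A) ∘ₗ TensorProduct.map (inl k A) (leftInv k A)
  have hmul (a : A) (t : A ⊗[k] A) : κ (inl k A a * t) = inl k A a * κ t := by
    induction t with
    | zero => simp
    | add x y hx hy => simp only [mul_add, map_add, hx, hy]
    | tmul b c => simp [κ, inl_apply, ← mul_assoc]
  have hκ : κ ∘ₗ E.toLinearMap ∘ₗ deltaL k A = .id := TensorProduct.ext' fun a b => by
    have hb : κ (Coalgebra.comul b) = inr k A b := LinearMap.congr_fun conv_inl_leftInv b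
    change κ (E (deltaL k A (a ⊗ₜ b))) = a ⊗ₜ b
    rw [map_counitLeft_deltaL_tmul, hmul, hb]
    simp [inl_apply, inr_apply]
  calc leftInv k A (counitLeft k A A x) = κ (E (deltaL k A x)) := by
        simp [hx, κ, E, inl_apply, ← Algebra.TensorProduct.one_def]
    _ = x := LinearMap.congr_fun hκ x

theorem maurerCartan_coe (a : A) :
    (maurerCartan k A a : A ⊗[k] A) = leftInv k A a - convUnit k A (A ⊗[k] A) a := by
  have h : conv (inl k A ∘ₗ HopfAlgebra.antipode k) (dU k A) =
      leftInv k A - convUnit k A (A ⊗[k] A) := by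
    rw [dU, conv_sub, leftInv]
    exact congrArg _ (antipode_conv (includeLeft : A →ₐ[k] A ⊗[k] A))
  exact LinearMap.congr_fun h a

variable {C : Type*} [Ring C] [HopfAlgebra k C]

theorem extendUnit_maurerCartan_comp {γ : C →ₗ[k] A} (h1 : γ 1 = 1)
    (hε : ∀ c, Coalgebra.counit (R := k) (γ c) = Coalgebra.counit (R := k) c) :
    extendUnit (maurerCartan k A ∘ₗ γ ∘ₗ (kerEps k C).subtype) = leftInv k A ∘ₗ γ := by
  refine extendUnit_eq (by rw [LinearMap.comp_apply, h1, leftInv_one]) fun c => ?_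
  rw [LinearMap.comp_apply, LinearMap.comp_apply, maurerCartan_coe, convUnit_apply]
  simp [hε]

theorem bijOn_maurerCartan_comp :
    Set.BijOn (fun γ : C →ₗ[k] A => maurerCartan k A ∘ₗ γ ∘ₗ (kerEps k C).subtype)
      {γ | γ 1 = 1 ∧ ∀ c, Coalgebra.counit (R := k) (γ c) = Coalgebra.counit (R := k) c}
      {f | IsLeftInvariant f} := by
  refine ⟨fun γ hγ => ?_, fun γ hγ γ' hγ' h => ?_, fun f hf => ?_⟩
  · rw [Set.mem_ofPred_eq, isLeftInvariant_iff, extendUnit_maurerCartan_comp hγ.1 hγ.2,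
      ← LinearMap.comp_assoc, deltaL_comp_leftInv, LinearMap.comp_assoc]
  · have hleft : leftInv k A ∘ₗ γ = leftInv k A ∘ₗ γ' := by
      rw [← extendUnit_maurerCartan_comp hγ.1 hγ.2, ← extendUnit_maurerCartan_comp hγ'.1 hγ'.2]
      exact congrArg extendUnit h
    rw [← LinearMap.id_comp γ, ← LinearMap.id_comp γ', ← counitLeft_comp_leftInv,
      LinearMap.comp_assoc, hleft, LinearMap.comp_assoc]
  · let γ : C →ₗ[k] A := (counitLeft k A A).toLinearMap ∘ₗ extendUnit f
    have h1 : γ 1 = 1 := by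
      change counitLeft k A A (extendUnit f 1) = 1
      rw [extendUnit_one, map_one]
    have hε (c : C) : Coalgebra.counit (R := k) (γ c) = Coalgebra.counit (R := k) c := by
      refine (counit_counitLeft _).trans ?_
      have := LinearMap.congr_fun (mul'_comp_extendUnit f) c
      rw [LinearMap.comp_apply] at this
      rw [this, convUnit_apply, Bialgebra.counit_algebraMap]
    refine ⟨γ, ⟨h1, hε⟩, extendUnit_injective ?_⟩
    rw [extendUnit_maurerCartan_comp h1 hε]
    exact LinearMap.ext fun c =>
      leftInv_counitLeft (LinearMap.congr_fun ((isLeftInvariant_iff f).1 hf) c)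

end LeftInvariant

section AdjointCoaction

variable {k A X : Type*} [Field k] [Ring A] [HopfAlgebra k A] [Ring X] [Algebra k X]

theorem rTensor_comp_Ad (f : A →ₗ[k] X) : f.rTensor A ∘ₗ Ad k A =
    conj includeRight includeRight ((includeLeft : X →ₐ[k] X ⊗[k] A).toLinearMap ∘ₗ f) := by
  ext a
  simp only [LinearMap.comp_apply, Ad, conj]
  rw [conv_apply]
  induction Coalgebra.comul (R := k) a with
  | zero => simp
  | add x y hx hy => simp only [map_add, hx, hy]
  | tmul x y =>
    simp only [TensorProduct.map_tmul, LinearMap.mul'_apply, LinearMap.lTensor_tmul]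
    rw [conv_apply]
    induction Coalgebra.comul (R := k) y with
    | zero => simp
    | add x y hx hy => simp only [map_add, TensorProduct.tmul_add, mul_add, hx, hy]
    | tmul z w => simp

theorem rTensor_AdKer {F : A →ₗ[k] X} (hF : F 1 = 1) (a : kerEps k A) :
    (F ∘ₗ (kerEps k A).subtype).rTensor A (AdKer k A a) = F.rTensor A (Ad k A a) := by
  have hunit : (convUnit k A X).rTensor A (Ad k A a) = 0 := by
    have := LinearMap.congr_fun (rTensor_comp_Ad (convUnit k A X)) a
    rwa [algHom_comp_convUnit, conj_self_convUnit, convUnit_apply, counit_coe_kerEps,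
      map_zero] at this
  calc (F ∘ₗ (kerEps k A).subtype).rTensor A (AdKer k A a)
      = (F ∘ₗ (kerEps k A).subtype ∘ₗ piEps k A).rTensor A (Ad k A a) := by
        rw [← LinearMap.comp_assoc, LinearMap.rTensor_comp_apply _ _ (piEps k A)]
        rfl
    _ = F.rTensor A (Ad k A a) := by
        rw [comp_piEps hF, LinearMap.rTensor_sub, LinearMap.sub_apply, hunit, sub_zero]

end AdjointCoaction

section Bundle

variable {k P H X : Type*} [Field k] [Ring P] [Algebra k P] [Ring H] [HopfAlgebra k H]
  [Ring X] [Algebra k X]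

/-- `u ↦ j(u₍₀₎) ⊗ u₍₁₎` for a coaction `δ(u) = u₍₀₎ ⊗ u₍₁₎`. With the two inclusions `P → P ⊗ P`
for `j` it describes the tensor product coaction on the generators of `P ⊗ P`. -/
def pushCoact (δ : P →ₐ[k] P ⊗[k] H) (j : P →ₐ[k] X) : P →ₐ[k] X ⊗[k] H :=
  (Algebra.TensorProduct.map j (.id k H)).comp δ

variable {δ : P →ₐ[k] P ⊗[k] H}

theorem deltaR₂_tmul (u v : P) : deltaR₂ δ.toLinearMap (u ⊗ₜ v) =
    pushCoact δ includeLeft u * pushCoact δ includeRight v := by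
  simp only [deltaR₂, LinearMap.comp_apply, pushCoact, AlgHom.comp_apply,
    TensorProduct.map_tmul, AlgHom.toLinearMap_apply]
  induction δ u with
  | zero => simp
  | add x y hx hy => simp only [TensorProduct.add_tmul, map_add, add_mul, hx, hy]
  | tmul x y =>
    induction δ v with
    | zero => simp
    | add x y hx hy => simp only [TensorProduct.tmul_add, map_add, mul_add, hx, hy]
    | tmul z w => simp

theorem chi_tmul (u v : P) :
    chi δ.toLinearMap (u ⊗ₜ v) = (includeLeft : P →ₐ[k] P ⊗[k] H) u * δ v := by
  simp only [chi, LinearMap.comp_apply, LinearMap.lTensor_tmul, AlgHom.toLinearMap_apply]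
  induction δ v with
  | zero => simp
  | add x y hx hy => simp only [TensorProduct.tmul_add, map_add, mul_add, hx, hy]
  | tmul z w => simp

theorem extendUnit_comp_subtype (ω : kerEps k H →ₗ[k] Omega k P) :
    extendUnit ω ∘ₗ (kerEps k H).subtype = (Omega k P).subtype ∘ₗ ω :=
  LinearMap.ext (extendUnit_coe ω)

theorem chi_extendUnit_iff (ω : kerEps k H →ₗ[k] Omega k P) :
    (∀ h : kerEps k H, chi δ.toLinearMap (ω h) = 1 ⊗ₜ (h : H)) ↔
      chi δ.toLinearMap ∘ₗ extendUnit ω = (includeRight : H →ₐ[k] P ⊗[k] H).toLinearMap := by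
  have hcoe (h : kerEps k H) : (chi δ.toLinearMap ∘ₗ extendUnit ω) h =
      (includeRight : H →ₐ[k] P ⊗[k] H).toLinearMap h ↔
        chi δ.toLinearMap (ω h) = 1 ⊗ₜ (h : H) := by
    rw [LinearMap.comp_apply, extendUnit_coe]
    rfl
  refine ⟨fun hω => ext_one_kerEps ?_ fun h => (hcoe h).2 (hω h),
    fun hω h => (hcoe h).1 (LinearMap.congr_fun hω h)⟩
  rw [LinearMap.comp_apply, extendUnit_one, map_one_of_map_tmul chi_tmul,
    AlgHom.toLinearMap_apply, map_one]

theorem deltaR₂_extendUnit_iff (ω : kerEps k H →ₗ[k] Omega k P) :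
    (∀ h : kerEps k H, deltaR₂ δ.toLinearMap (ω h) =
        ((Omega k P).subtype ∘ₗ ω).rTensor H (AdKer k H h)) ↔
      deltaR₂ δ.toLinearMap ∘ₗ extendUnit ω = (extendUnit ω).rTensor H ∘ₗ Ad k H := by
  have hcoe (h : kerEps k H) : (deltaR₂ δ.toLinearMap ∘ₗ extendUnit ω) h =
      ((extendUnit ω).rTensor H ∘ₗ Ad k H) h ↔
        deltaR₂ δ.toLinearMap (ω h) = ((Omega k P).subtype ∘ₗ ω).rTensor H (AdKer k H h) := by
    rw [LinearMap.comp_apply, LinearMap.comp_apply, extendUnit_coe, ← extendUnit_comp_subtype,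
      rTensor_AdKer (extendUnit_one ω)]
  refine ⟨fun hω => ext_one_kerEps ?_ fun h => (hcoe h).2 (hω h),
    fun hω h => (hcoe h).1 (LinearMap.congr_fun hω h)⟩
  rw [rTensor_comp_Ad, conj_apply_one, LinearMap.comp_apply, LinearMap.comp_apply,
    extendUnit_one, map_one_of_map_tmul deltaR₂_tmul, AlgHom.toLinearMap_apply, map_one]

theorem isConnection_iff (ω : kerEps k H →ₗ[k] Omega k P) :
    IsConnection δ.toLinearMap ω ↔
      chi δ.toLinearMap ∘ₗ extendUnit ω = (includeRight : H →ₐ[k] P ⊗[k] H).toLinearMap ∧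
      deltaR₂ δ.toLinearMap ∘ₗ extendUnit ω = (extendUnit ω).rTensor H ∘ₗ Ad k H :=
  and_congr (chi_extendUnit_iff ω) (deltaR₂_extendUnit_iff ω)

end Bundle

section Trivialisation

variable {k P H X : Type*} [Field k] [Ring P] [Algebra k P] [Ring H] [HopfAlgebra k H]
  [Ring X] [Algebra k X] {δ : P →ₐ[k] P ⊗[k] H} {φ : H →ₐ[k] P}

variable (δ φ) in
/-- The equivariance `δ(φ(h)) = φ(h₁) ⊗ h₂` of a trivialisation `φ`. Its convolution inverse
is `φ ∘ S`, as `φ` is taken to be an algebra map. -/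
structure IsTrivialisation : Prop where
  coact_comp : (δ.comp φ).toLinearMap = conv (includeLeft.comp φ).toLinearMap
    (includeRight : H →ₐ[k] P ⊗[k] H).toLinearMap

theorem pushCoact_comp_eq_conv (j : P →ₐ[k] X) (hφ : IsTrivialisation δ φ) :
    ((pushCoact δ j).comp φ).toLinearMap =
      conv (includeLeft.toLinearMap ∘ₗ (j.comp φ).toLinearMap)
        (includeRight : H →ₐ[k] X ⊗[k] H).toLinearMap := by
  have hmap : (Algebra.TensorProduct.map j (.id k H)).toLinearMap ∘ₗ (δ.comp φ).toLinearMap =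
      ((pushCoact δ j).comp φ).toLinearMap := rfl
  rw [← hmap, hφ.coact_comp, algHom_comp_conv]
  congr 1
  ext h
  simp

theorem isConnection_iff_of_conj (hφ : IsTrivialisation δ φ)
    {ω : kerEps k H →ₗ[k] Omega k P} {B : H →ₗ[k] P ⊗[k] P}
    (hω : extendUnit ω = conj (includeLeft.comp φ) (includeRight.comp φ) B) :
    IsConnection δ.toLinearMap ω ↔
      chi δ.toLinearMap ∘ₗ B = convUnit k H (P ⊗[k] H) ∧
      deltaR₂ δ.toLinearMap ∘ₗ B =
        (includeLeft : P ⊗[k] P →ₐ[k] (P ⊗[k] P) ⊗[k] H).toLinearMap ∘ₗ B := by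
  have hright : conj (includeLeft.comp φ) (δ.comp φ) (convUnit k H (P ⊗[k] H)) =
      (includeRight : H →ₐ[k] P ⊗[k] H).toLinearMap := by
    rw [conj_eq_iff, convUnit_conv, hφ.coact_comp]
  rw [isConnection_iff, hω, comp_conj_includeLeft_includeRight chi_tmul, ← hright,
    (conj_injective _ _).eq_iff, rTensor_comp_Ad, comp_conj_includeLeft_includeRight deltaR₂_tmul,
    conj_eq_conj_iff (pushCoact_comp_eq_conv _ hφ) (pushCoact_comp_eq_conv _ hφ),
    ← algHom_comp_conv, conv_conj, algHom_comp_conv]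
  refine and_congr_right fun _ => ⟨fun h => conv_right_cancel (conv_antipode
    ((includeLeft : P ⊗[k] P →ₐ[k] (P ⊗[k] P) ⊗[k] H).comp (includeRight.comp φ))) h,
    fun h => by rw [h]⟩

end Trivialisation

section Base

variable {k P H : Type*} [Field k] [Ring P] [Algebra k P] [Ring H] [HopfAlgebra k H]
  {δ : P →ₐ[k] P ⊗[k] H}

theorem mem_base {u : P} : u ∈ base δ.toLinearMap ↔ δ u = u ⊗ₜ 1 := Iff.rfl

theorem one_mem_base : (1 : P) ∈ base δ.toLinearMap := by
  rw [mem_base, map_one, Algebra.TensorProduct.one_def]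

theorem mul_mem_base {u v : P} (hu : u ∈ base δ.toLinearMap) (hv : v ∈ base δ.toLinearMap) :
    u * v ∈ base δ.toLinearMap := by
  rw [mem_base] at hu hv ⊢
  rw [map_mul, hu, hv, Algebra.TensorProduct.tmul_mul_tmul, one_mul]

theorem dU_mem_baseOmega {m : P} (hm : m ∈ base δ.toLinearMap) :
    dU k P m ∈ baseOmega δ.toLinearMap := by
  refine ⟨mul'_dU k P m, ?_⟩
  rw [TensorProduct.range_mapIncl]
  exact sub_mem (Submodule.apply_mem_map₂ _ one_mem_base hm)
    (Submodule.apply_mem_map₂ _ hm one_mem_base)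

theorem inl_mul_mem_baseOmega {m : P} (hm : m ∈ base δ.toLinearMap) {x : P ⊗[k] P}
    (hx : x ∈ baseOmega δ.toLinearMap) : inl k P m * x ∈ baseOmega δ.toLinearMap := by
  obtain ⟨hmul, z, rfl⟩ := hx
  refine ⟨(mul'_inl_mul k P m _).trans (by rw [show LinearMap.mul' k P _ = 0 from hmul, mul_zero]),
    ?_⟩
  clear hmul
  induction z with
  | zero => simp
  | add x y hx hy =>
    rw [map_add, mul_add]
    exact add_mem hx hy
  | tmul a b => exact ⟨⟨m * a, mul_mem_base hm a.2⟩ ⊗ₜ b, by simp [inl_apply]⟩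

theorem mul_inr_mem_baseOmegaMul {x : P ⊗[k] P} (hx : x ∈ baseOmega δ.toLinearMap) (p : P) :
    x * inr k P p ∈ baseOmegaMul δ.toLinearMap :=
  Submodule.subset_span ⟨x, hx, p, rfl⟩

theorem baseOmegaMul_mul_inr_mem {x : P ⊗[k] P} (hx : x ∈ baseOmegaMul δ.toLinearMap) (p : P) :
    x * inr k P p ∈ baseOmegaMul δ.toLinearMap := by
  induction hx using Submodule.span_induction with
  | zero => simp
  | add x y _ _ hx hy =>
    rw [add_mul]
    exact add_mem hx hy
  | smul c x _ hx =>
    rw [smul_mul_assoc]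
    exact Submodule.smul_mem _ _ hx
  | mem x hx =>
    obtain ⟨y, hy, q, rfl⟩ := hx
    have hq : inr k P q * inr k P p = inr k P (q * p) := by simp [inr_apply]
    rw [mul_assoc, hq]
    exact mul_inr_mem_baseOmegaMul hy _

theorem inl_mul_mem_baseOmegaMul {m : P} (hm : m ∈ base δ.toLinearMap) {x : P ⊗[k] P}
    (hx : x ∈ baseOmegaMul δ.toLinearMap) : inl k P m * x ∈ baseOmegaMul δ.toLinearMap := by
  induction hx using Submodule.span_induction with
  | zero => simp
  | add x y _ _ hx hy =>
    rw [mul_add]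
    exact add_mem hx hy
  | smul c x _ hx =>
    rw [mul_smul_comm]
    exact Submodule.smul_mem _ _ hx
  | mem x hx =>
    obtain ⟨y, hy, q, rfl⟩ := hx
    rw [← mul_assoc]
    exact mul_inr_mem_baseOmegaMul (inl_mul_mem_baseOmega hm hy) q

variable (δ) in
theorem baseOmegaMul_le :
    baseOmegaMul δ.toLinearMap ≤ LinearMap.range ((base δ.toLinearMap).subtype.rTensor P) := by
  refine Submodule.span_le.2 ?_
  rintro _ ⟨_, ⟨-, z, rfl⟩, p, rfl⟩
  induction z with
  | zero => simp
  | add x y hx hy =>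
    rw [map_add, add_mul]
    exact add_mem hx hy
  | tmul a b => exact ⟨a ⊗ₜ (b * p), by simp [inr_apply]⟩

theorem chi_of_mem_range_mapIncl {x : P ⊗[k] P} (hx : x ∈ LinearMap.range
    (TensorProduct.mapIncl (base δ.toLinearMap) (base δ.toLinearMap))) :
    chi δ.toLinearMap x = LinearMap.mul' k P x ⊗ₜ 1 := by
  obtain ⟨z, rfl⟩ := hx
  induction z with
  | zero => simp
  | add x y hx hy => simp only [map_add, TensorProduct.add_tmul, hx, hy]
  | tmul a b => simp [chi_tmul, mem_base.1 b.2]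

theorem deltaR₂_of_mem_range_mapIncl {x : P ⊗[k] P} (hx : x ∈ LinearMap.range
    (TensorProduct.mapIncl (base δ.toLinearMap) (base δ.toLinearMap))) :
    deltaR₂ δ.toLinearMap x = x ⊗ₜ 1 := by
  obtain ⟨z, rfl⟩ := hx
  induction z with
  | zero => simp
  | add x y hx hy => simp only [map_add, TensorProduct.add_tmul, hx, hy]
  | tmul a b => simp [deltaR₂_tmul, pushCoact, mem_base.1 a.2, mem_base.1 b.2]

/-- `B ⊗ P` meets the coinvariants of `P ⊗ P` in `B ⊗ B`, as `B` is the kernel of `δ - (· ⊗ 1)` and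
tensoring with `B` is exact. -/
theorem mem_range_mapIncl_of_deltaR₂_eq {x : P ⊗[k] P}
    (hx : x ∈ LinearMap.range ((base δ.toLinearMap).subtype.rTensor P))
    (h : deltaR₂ δ.toLinearMap x = x ⊗ₜ 1) : x ∈ LinearMap.range
      (TensorProduct.mapIncl (base δ.toLinearMap) (base δ.toLinearMap)) := by
  set N := base δ.toLinearMap
  obtain ⟨y, rfl⟩ := hx
  let ι := (TensorProduct.assoc k P P H).symm.toLinearMap ∘ₗ N.subtype.rTensor (P ⊗[k] H)
  have hι : Function.Injective ι := (TensorProduct.assoc k P P H).symm.injective.comp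
    (Module.Flat.rTensor_preserves_injective_linearMap _ N.injective_subtype)
  have hcoact : deltaR₂ δ.toLinearMap ∘ₗ N.subtype.rTensor P =
      ι ∘ₗ δ.toLinearMap.lTensor N := TensorProduct.ext' fun a b => by
    simp only [LinearMap.comp_apply, LinearMap.rTensor_tmul, LinearMap.lTensor_tmul,
      deltaR₂_tmul, pushCoact, AlgHom.comp_apply, Submodule.subtype_apply, mem_base.1 a.2, ι,
      AlgHom.toLinearMap_apply]
    induction δ b with
    | zero => simp
    | add x y hx hy => simp only [map_add, mul_add, TensorProduct.tmul_add, hx, hy]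
    | tmul u v => simp
  have hunit : (TensorProduct.mk k (P ⊗[k] P) H).flip 1 ∘ₗ N.subtype.rTensor P =
      ι ∘ₗ ((TensorProduct.mk k P H).flip 1).lTensor N :=
    TensorProduct.ext' fun a b => by simp [ι]
  have hy : y ∈ LinearMap.eqLocus (TensorProduct.AlgebraTensorModule.lTensor k N δ.toLinearMap)
      (TensorProduct.AlgebraTensorModule.lTensor k N ((TensorProduct.mk k P H).flip 1)) :=
    hι <| (LinearMap.congr_fun hcoact y).symm.trans (h.trans (LinearMap.congr_fun hunit y :))
  rw [Module.Flat.eqLocus_lTensor_eq] at hy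
  obtain ⟨z, rfl⟩ := hy
  exact ⟨z, (LinearMap.congr_fun (LinearMap.rTensor_comp_lTensor _ N.subtype N.subtype) z).symm⟩

end Base

section Strong

variable {k P H : Type*} [Field k] [Ring P] [Algebra k P] [Ring H] [HopfAlgebra k H]
  {δ : P →ₐ[k] P ⊗[k] H} {φ : H →ₐ[k] P} {ω : kerEps k H →ₗ[k] Omega k P} {B : H →ₗ[k] P ⊗[k] P}

theorem connProj_dU_mul (hφ : IsTrivialisation δ φ)
    (hω : extendUnit ω = conj (includeLeft.comp φ) (includeRight.comp φ) B)
    {m : P} (hm : m ∈ base δ.toLinearMap) (h : H) :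
    connProj δ.toLinearMap ω (dU k P (m * φ h)) =
      inl k P m * (conv B (includeRight.comp φ).toLinearMap h - inl k P (φ h)) := by
  let ω₀ := (Omega k P).subtype ∘ₗ ω ∘ₗ piEps k H
  let κ : P ⊗[k] H →ₗ[k] P ⊗[k] P :=
    LinearMap.mul' k (P ⊗[k] P) ∘ₗ TensorProduct.map (inl k P) ω₀
  have hκ_one (u : P) : κ (u ⊗ₜ 1) = 0 := by simp [κ, ω₀, piEps_one]
  have hκ_mul (u : P) (x : P ⊗[k] H) : κ (u ⊗ₜ 1 * x) = inl k P u * κ x := by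
    induction x with
    | zero => simp
    | add x y hx hy => simp only [mul_add, map_add, hx, hy]
    | tmul u v => simp [κ, inl_apply, ← mul_assoc]
  have hκ_φ : κ ∘ₗ (δ.comp φ).toLinearMap = conv (includeLeft.comp φ).toLinearMap ω₀ := by
    rw [hφ.coact_comp]
    exact comp_conv_eq_conv fun c d => by simp [κ, inl_apply]
  have hω₀ : conv (includeLeft.comp φ).toLinearMap ω₀ =
      conv B (includeRight.comp φ).toLinearMap - (includeLeft.comp φ).toLinearMap := by
    rw [show ω₀ = extendUnit ω - convUnit k H (P ⊗[k] P) from (add_sub_cancel_right _ _).symm,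
      conv_sub, hω, conv_conj, conv_convUnit]
  have hchi (u : P) : chi δ.toLinearMap (dU k P u) = δ u - u ⊗ₜ 1 := by
    simp [dU, inl_apply, inr_apply, chi_tmul, ← Algebra.TensorProduct.one_def]
  calc connProj δ.toLinearMap ω (dU k P (m * φ h))
      = κ (chi δ.toLinearMap (dU k P (m * φ h))) := rfl
    _ = inl k P m * κ (δ (φ h)) := by
      rw [hchi, map_sub, hκ_one, sub_zero, map_mul, mem_base.1 hm, hκ_mul]
    _ = _ := congrArg _ (LinearMap.congr_fun (hκ_φ.trans hω₀) h)

theorem dU_sub_connProj (hφ : IsTrivialisation δ φ)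
    (hω : extendUnit ω = conj (includeLeft.comp φ) (includeRight.comp φ) B)
    {m : P} (hm : m ∈ base δ.toLinearMap) (h : H) :
    dU k P (m * φ h) - connProj δ.toLinearMap ω (dU k P (m * φ h)) =
      dU k P m * inr k P (φ h) - inl k P m *
        conv (B - convUnit k H (P ⊗[k] P)) (includeRight.comp φ).toLinearMap h := by
  rw [connProj_dU_mul hφ hω hm, sub_conv, convUnit_conv]
  simp only [dU, inl_apply, inr_apply, LinearMap.sub_apply, AlgHom.toLinearMap_apply,
    AlgHom.comp_apply, Algebra.TensorProduct.includeRight_apply, mul_sub, sub_mul,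
    Algebra.TensorProduct.tmul_mul_tmul, one_mul, mul_one]
  abel

theorem isStrong_iff (hφ : IsTrivialisation δ φ)
    (hgen : ∀ u : P, u ∈ base δ.toLinearMap * LinearMap.range φ.toLinearMap)
    (hω : extendUnit ω = conj (includeLeft.comp φ) (includeRight.comp φ) B) :
    IsStrong δ.toLinearMap ω ↔
      ∀ h, B h - convUnit k H (P ⊗[k] P) h ∈ baseOmegaMul δ.toLinearMap := by
  let ψ : H →ₐ[k] P ⊗[k] P := includeRight.comp φ
  refine ⟨fun hstrong => ?_, fun hB u => ?_⟩
  · have hψ (h : H) : conv (B - convUnit k H (P ⊗[k] P)) ψ.toLinearMap h ∈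
        baseOmegaMul δ.toLinearMap := by
      have := hstrong (1 * φ h)
      rw [dU_sub_connProj hφ hω one_mem_base] at this
      have hd : dU k P (1 : P) = 0 := sub_self (1 : P ⊗[k] P)
      rwa [hd, zero_mul, inl_apply, ← Algebra.TensorProduct.one_def, one_mul, zero_sub,
        neg_mem_iff] at this
    have hcancel : B - convUnit k H (P ⊗[k] P) = conv (conv (B - convUnit k H (P ⊗[k] P))
        ψ.toLinearMap) (ψ.toLinearMap ∘ₗ HopfAlgebra.antipode k) := by
      rw [conv_assoc, conv_antipode, conv_convUnit]
    intro h
    rw [← LinearMap.sub_apply, hcancel]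
    exact conv_mem (fun c d => baseOmegaMul_mul_inr_mem (hψ c) _) h
  · induction hgen u using Submodule.mul_induction_on' with
    | add x _ y _ hx hy =>
      rw [map_add, map_add, add_sub_add_comm]
      exact add_mem hx hy
    | mem_mul_mem m hm _ hp =>
      obtain ⟨h, rfl⟩ := hp
      refine (dU_sub_connProj hφ hω hm h).symm ▸
        sub_mem (mul_inr_mem_baseOmegaMul (dU_mem_baseOmega hm) _)
          (inl_mul_mem_baseOmegaMul hm ?_)
      exact conv_mem (fun c d => baseOmegaMul_mul_inr_mem (hB c) _) h

theorem mul'_comp_of_conj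
    (hω : extendUnit ω = conj (includeLeft.comp φ) (includeRight.comp φ) B) :
    LinearMap.mul' k P ∘ₗ B = convUnit k H P := by
  have hmul (a b : P) : LinearMap.mul' k P (a ⊗ₜ b) = AlgHom.id k P a * AlgHom.id k P b := rfl
  have := mul'_comp_extendUnit ω
  rw [hω, comp_conj_includeLeft_includeRight hmul, ← conj_self_convUnit φ] at this
  exact conj_injective _ _ this

theorem isConnection_and_isStrong_iff (hφ : IsTrivialisation δ φ)
    (hgen : ∀ u : P, u ∈ base δ.toLinearMap * LinearMap.range φ.toLinearMap)
    (hω : extendUnit ω = conj (includeLeft.comp φ) (includeRight.comp φ) B) :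
    IsConnection δ.toLinearMap ω ∧ IsStrong δ.toLinearMap ω ↔
      ∀ h, B h - convUnit k H (P ⊗[k] P) h ∈ baseOmega δ.toLinearMap := by
  let N := base δ.toLinearMap
  have hunit (h : H) : convUnit k H (P ⊗[k] P) h ∈
      LinearMap.range (TensorProduct.mapIncl N N) := by
    rw [convUnit_apply, Algebra.algebraMap_eq_smul_one]
    exact Submodule.smul_mem _ _ ⟨⟨1, one_mem_base⟩ ⊗ₜ ⟨1, one_mem_base⟩, rfl⟩
  have hmul (h : H) : LinearMap.mul' k P (B h) = convUnit k H P h :=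
    LinearMap.congr_fun (mul'_comp_of_conj hω) h
  have hmem (h : H) : B h - convUnit k H (P ⊗[k] P) h ∈ baseOmega δ.toLinearMap ↔
      B h ∈ LinearMap.range (TensorProduct.mapIncl N N) := by
    have hker : LinearMap.mul' k P (B h - convUnit k H (P ⊗[k] P) h) = 0 := by
      rw [map_sub, hmul]
      simp [convUnit_apply, Algebra.TensorProduct.algebraMap_apply]
    exact (and_iff_right hker).trans (Submodule.sub_mem_iff_left _ (hunit h))
  rw [isConnection_iff_of_conj hφ hω, isStrong_iff hφ hgen hω]
  refine ⟨fun ⟨⟨_, hinv⟩, hstrong⟩ h => (hmem h).2 ?_, fun hB => ⟨⟨?_, ?_⟩, fun h => ?_⟩⟩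
  · refine mem_range_mapIncl_of_deltaR₂_eq ?_ (LinearMap.congr_fun hinv h)
    have hle : LinearMap.range (TensorProduct.mapIncl N N) ≤
        LinearMap.range (N.subtype.rTensor P) := by
      rw [TensorProduct.mapIncl, ← LinearMap.rTensor_comp_lTensor]
      exact LinearMap.range_comp_le_range _ _
    exact (Submodule.sub_mem_iff_left _ (hle (hunit h))).1 (baseOmegaMul_le δ (hstrong h))
  · ext h
    rw [LinearMap.comp_apply, chi_of_mem_range_mapIncl ((hmem h).1 (hB h)), hmul]
    rfl
  · exact LinearMap.ext fun h => deltaR₂_of_mem_range_mapIncl ((hmem h).1 (hB h))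
  · have := mul_inr_mem_baseOmegaMul (hB h) 1
    rwa [inr_apply, ← Algebra.TensorProduct.one_def, mul_one] at this

end Strong

namespace Bicross

variable {k M H : Type*} [Field k] [Ring M] [Ring H] [HopfAlgebra k M] [HopfAlgebra k H]
  (D : MatchedPair k M H)

theorem proj_rel :
    CrossRel D ((Algebra.ofId k H).comp (Bialgebra.counitAlgHom k M)) (.id k H) := by
  intro n
  have hact : ((Algebra.ofId k H).comp (Bialgebra.counitAlgHom k M)).toLinearMap ∘ₗ
      D.act.toLinearMap.flip n = LinearMap.mulLeft k (algebraMap k H (Coalgebra.counit n)) ∘ₗ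
        convUnit k H H := by
    ext h
    simp [D.counit_act, Algebra.ofId_apply, convUnit_apply, ← map_mul, mul_comm]
  rw [hact, AlgHom.toLinearMap_id, ← mulLeft_comp_conv, convUnit_conv]
  ext h
  simp [Algebra.ofId_apply, (Algebra.commutes _ _).symm]

/-- The projection `π` as an algebra map. -/
def projHom : Bicross D →ₐ[k] H :=
  lift D ((Algebra.ofId k H).comp (Bialgebra.counitAlgHom k M)) (.id k H) (proj_rel D)

theorem proj_tm (m : M) (h : H) : proj D (tm D m h) = Coalgebra.counit (R := k) m • h := by
  simp [proj, tm]

theorem proj_eq : proj D = (projHom D).toLinearMap := by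
  ext x
  induction x using induction with
  | zero => simp
  | add x y hx hy => simp only [map_add, hx, hy]
  | tmul m h =>
    rw [proj_tm, AlgHom.toLinearMap_apply, projHom, lift_tm]
    simp [Algebra.ofId_apply, Algebra.smul_def]

theorem projHom_incl (m : M) : projHom D (incl D m) = algebraMap k H (Coalgebra.counit m) :=
  lift_incl ..

theorem projHom_Phi (h : H) : projHom D (Phi D h) = h := lift_Phi ..

/-- The coaction `Δ_R` of `H` as an algebra map. -/
def deltaRHom : Bicross D →ₐ[k] Bicross D ⊗[k] H :=
  pushComul (projHom D)

theorem deltaR_eq : deltaR D = (deltaRHom D).toLinearMap := by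
  rw [deltaR, proj_eq]
  rfl

theorem deltaRHom_incl (m : M) : deltaRHom D (incl D m) = incl D m ⊗ₜ 1 := by
  have hcounit := congrArg (TensorProduct.map (incl D).toLinearMap (Algebra.linearMap k H))
    (Coalgebra.lTensor_counit_comul (R := k) m)
  change Algebra.TensorProduct.map (.id k (Bicross D)) (projHom D) (comulHom D (incl D m)) = _
  rw [comulHom_incl]
  refine Eq.trans ?_ (hcounit.trans (by simp))
  induction Coalgebra.comul (R := k) m with
  | zero => simp
  | add x y hx hy => simp only [map_add, hx, hy]
  | tmul x y => simp [projHom_incl]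

theorem isTrivialisation_Phi : IsTrivialisation (deltaRHom D) (Phi D) := by
  constructor
  have hcomul : ((deltaRHom D).comp (Phi D)).toLinearMap =
      (Algebra.TensorProduct.map (.id k (Bicross D)) (projHom D)).toLinearMap ∘ₗ
        (comulPhi D).toLinearMap :=
    LinearMap.ext fun h =>
      congrArg (Algebra.TensorProduct.map (.id k (Bicross D)) (projHom D)) (comulHom_Phi D h)
  rw [hcomul, comulPhi_toLinearMap, algHom_comp_conv]
  congr 1
  · ext h
    have hcounit := congrArg (fun g => Phi D g ⊗ₜ[k] (1 : H)) (D.coact_counit h)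
    refine Eq.trans ?_ hcounit
    simp only [coactP, LinearMap.comp_apply]
    induction D.coact h with
    | zero => simp
    | add x y hx hy => simp only [map_add, TensorProduct.add_tmul, hx, hy]
    | tmul g n =>
      simp [PhiIncl, projHom_incl, Algebra.algebraMap_eq_smul_one, TensorProduct.smul_tmul]
  · ext h
    simp [oneP, projHom_Phi]

/-- The retraction `m ⊗ h ↦ m ε(h)` of the inclusion of the base `M`. -/
def retr : Bicross D →ₗ[k] M :=
  (TensorProduct.rid k M).toLinearMap ∘ₗ
    (Coalgebra.counit (R := k) (A := H)).lTensor M ∘ₗ (of D).symm.toLinearMap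

theorem retr_tm (m : M) (h : H) : retr D (tm D m h) = Coalgebra.counit (R := k) h • m := by
  simp [retr, tm]

theorem retr_incl (m : M) : retr D (incl D m) = m := by
  rw [incl_apply, retr_tm, Bialgebra.counit_one, one_smul]

theorem rTensor_retr_deltaRHom (u : Bicross D) :
    (retr D).rTensor H (deltaRHom D u) = (of D).symm u := by
  induction u using induction with
  | zero => simp
  | add x y hx hy => simp only [map_add, hx, hy]
  | tmul m h =>
    have hPhi : deltaRHom D (Phi D h) = (Phi D).toLinearMap.rTensor H (Coalgebra.comul h) :=
      (LinearMap.congr_fun (isTrivialisation_Phi D).coact_comp h).trans <| LinearMap.congr_fun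
        (comp_comul_eq_conv (T := (Phi D).toLinearMap.rTensor H) fun c d => by simp).symm h
    have hcounit := congrArg (fun g => m ⊗ₜ[k] TensorProduct.lid k H g)
      (Coalgebra.rTensor_counit_comul (R := k) h)
    rw [← incl_mul_Phi, map_mul, deltaRHom_incl, hPhi, incl_mul_Phi]
    refine Eq.trans ?_ (hcounit.trans (by simp [tm]))
    induction Coalgebra.comul (R := k) h with
    | zero => simp
    | add x y hx hy => simp only [map_add, mul_add, TensorProduct.tmul_add, hx, hy]
    | tmul x y => simp [incl_mul_Phi, retr_tm, TensorProduct.smul_tmul]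

theorem base_eq : base (deltaR D) = LinearMap.range (incl D).toLinearMap := by
  rw [deltaR_eq]
  ext u
  constructor
  · intro hu
    have := rTensor_retr_deltaRHom D u
    rw [mem_base.1 hu, LinearMap.rTensor_tmul] at this
    exact ⟨retr D u, congrArg (of D) this⟩
  · rintro ⟨m, rfl⟩
    exact deltaRHom_incl D m

theorem mem_base_mul_range_Phi (u : Bicross D) :
    u ∈ base (deltaR D) * LinearMap.range (Phi D).toLinearMap := by
  rw [base_eq]
  induction u using induction with
  | zero => exact zero_mem _
  | add x y hx hy => exact add_mem hx hy
  | tmul m h => exact incl_mul_Phi D m h ▸ Submodule.mul_mem_mul ⟨m, rfl⟩ ⟨h, rfl⟩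

/-- The inclusion of `M ⊗ M` in `(M ▶◁ H) ⊗ (M ▶◁ H)`. -/
def inclIncl : M ⊗[k] M →ₐ[k] Bicross D ⊗[k] Bicross D :=
  Algebra.TensorProduct.map (incl D) (incl D)

theorem retr_inclIncl (x : M ⊗[k] M) :
    TensorProduct.map (retr D) (retr D) (inclIncl D x) = x := by
  induction x with
  | zero => simp
  | add x y hx hy => simp only [map_add, hx, hy]
  | tmul a b => simp [inclIncl, retr_incl]

theorem inclIncl_injective : Function.Injective (inclIncl D) :=
  Function.LeftInverse.injective (retr_inclIncl D)

theorem mul'_inclIncl (x : M ⊗[k] M) : LinearMap.mul' k (Bicross D) (inclIncl D x) =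
    incl D (LinearMap.mul' k M x) := by
  induction x with
  | zero => simp
  | add x y hx hy => simp only [map_add, hx, hy]
  | tmul a b => simp [inclIncl]

theorem baseOmega_eq :
    baseOmega (deltaR D) = (Omega k M).map (inclIncl D).toLinearMap := by
  have hrange : LinearMap.range (TensorProduct.mapIncl (base (deltaR D)) (base (deltaR D))) =
      LinearMap.range (inclIncl D).toLinearMap := by
    rw [TensorProduct.range_mapIncl, base_eq]
    exact (TensorProduct.range_map (incl D).toLinearMap (incl D).toLinearMap).symm
  have hmul (x : M ⊗[k] M) : inclIncl D x ∈ Omega k (Bicross D) ↔ x ∈ Omega k M := by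
    rw [Omega, Omega, LinearMap.mem_ker, LinearMap.mem_ker, mul'_inclIncl, ← map_zero (incl D),
      (Function.LeftInverse.injective (retr_incl D)).eq_iff]
  ext y
  rw [baseOmega, hrange]
  constructor
  · rintro ⟨hy, x, rfl⟩
    exact ⟨x, (hmul x).1 hy, rfl⟩
  · rintro ⟨x, hx, rfl⟩
    exact ⟨(hmul x).2 hx, x, rfl⟩

theorem extendUnit_connectionOfBeta (β : kerEps k H →ₗ[k] Omega k M) :
    extendUnit (connectionOfBeta D β) = conj (includeLeft.comp (Phi D))
      (includeRight.comp (Phi D)) ((inclIncl D).toLinearMap ∘ₗ extendUnit β) := by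
  let l : H →ₐ[k] Bicross D ⊗[k] Bicross D := includeLeft.comp (Phi D)
  let r : H →ₐ[k] Bicross D ⊗[k] Bicross D := includeRight.comp (Phi D)
  have hβ : (inclIncl D).toLinearMap ∘ₗ extendUnit β =
      betaP D β + convUnit k H (Bicross D ⊗[k] Bicross D) := by
    rw [extendUnit, LinearMap.comp_add, algHom_comp_convUnit]
    rfl
  have hω : conj l r (betaP D β + convUnit k H (Bicross D ⊗[k] Bicross D)) =
      conv (l.toLinearMap ∘ₗ HopfAlgebra.antipode k) (conv (betaP D β) r.toLinearMap) +
        conv (l.toLinearMap ∘ₗ HopfAlgebra.antipode k) (r.toLinearMap - l.toLinearMap) +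
          convUnit k H (Bicross D ⊗[k] Bicross D) := by
    rw [conj, add_conv, conv_add, convUnit_conv, conv_sub, antipode_conv, add_assoc,
      sub_add_cancel]
  refine extendUnit_eq ?_ fun h => ?_
  · rw [conj_apply_one, LinearMap.comp_apply, extendUnit_one, AlgHom.toLinearMap_apply, map_one]
  · rw [hβ, hω, LinearMap.add_apply, convUnit_apply, counit_coe_kerEps, map_zero, add_zero]
    rfl

theorem connectionOfBeta_injective : Function.Injective (connectionOfBeta D) := fun β β' h => by
  have := congrArg extendUnit h
  rw [extendUnit_connectionOfBeta, extendUnit_connectionOfBeta] at this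
  exact extendUnit_injective <| LinearMap.ext fun a =>
    inclIncl_injective D (LinearMap.congr_fun (conj_injective _ _ this) a)

theorem inclIncl_extendUnit_sub (β : kerEps k H →ₗ[k] Omega k M) (h : H) :
    inclIncl D (extendUnit β h) - convUnit k H (Bicross D ⊗[k] Bicross D) h =
      inclIncl D (β (piEps k H h)) := by
  rw [← algHom_comp_convUnit (inclIncl D), extendUnit_apply, map_add]
  exact add_sub_cancel_right _ _

theorem exists_inclIncl_comp_extendUnit {B : H →ₗ[k] Bicross D ⊗[k] Bicross D} (h1 : B 1 = 1)
    (hB : ∀ h, B h - convUnit k H (Bicross D ⊗[k] Bicross D) h ∈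
      (Omega k M).map (inclIncl D).toLinearMap) :
    ∃ β : kerEps k H →ₗ[k] Omega k M, (inclIncl D).toLinearMap ∘ₗ extendUnit β = B := by
  let F : H →ₗ[k] M ⊗[k] M := TensorProduct.map (retr D) (retr D) ∘ₗ B
  have hF (h : H) :
      F h - convUnit k H (M ⊗[k] M) h ∈ Omega k M ∧ inclIncl D (F h) = B h := by
    obtain ⟨x, hx, hxB⟩ := hB h
    have hBx : B h = inclIncl D (x + convUnit k H (M ⊗[k] M) h) := by
      rw [← algHom_comp_convUnit (inclIncl D)] at hxB
      exact (eq_add_of_sub_eq hxB.symm).trans (map_add (inclIncl D) _ _).symm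
    have hFx : F h = x + convUnit k H (M ⊗[k] M) h := by
      rw [LinearMap.comp_apply, hBx, retr_inclIncl]
    rw [hFx, add_sub_cancel_right]
    exact ⟨hx, hBx.symm⟩
  have hF1 : F 1 = 1 := by
    rw [LinearMap.comp_apply, h1, ← map_one (inclIncl D), retr_inclIncl]
  obtain ⟨β, hβ⟩ := exists_extendUnit hF1 fun h => (hF h).1
  exact ⟨β, hβ ▸ LinearMap.ext fun h => (hF h).2⟩

theorem range_connectionOfBeta :
    Set.range (connectionOfBeta D) = {ω | IsConnection (deltaR D) ω ∧ IsStrong (deltaR D) ω} := by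
  have hiff {ω : kerEps k H →ₗ[k] Omega k (Bicross D)} {B : H →ₗ[k] Bicross D ⊗[k] Bicross D}
      (hω : extendUnit ω = conj (includeLeft.comp (Phi D)) (includeRight.comp (Phi D)) B) :
      IsConnection (deltaR D) ω ∧ IsStrong (deltaR D) ω ↔
        ∀ h, B h - convUnit k H _ h ∈ (Omega k M).map (inclIncl D).toLinearMap := by
    have hgen := mem_base_mul_range_Phi D
    rw [deltaR_eq] at hgen
    rw [← baseOmega_eq, deltaR_eq]
    exact isConnection_and_isStrong_iff (isTrivialisation_Phi D) hgen hω
  refine Set.Subset.antisymm ?_ fun ω hω => ?_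
  · rintro _ ⟨β, rfl⟩
    exact (hiff (extendUnit_connectionOfBeta D β)).2 fun h =>
      ⟨β (piEps k H h), (β (piEps k H h)).2, (inclIncl_extendUnit_sub D β h).symm⟩
  · obtain ⟨B, hB⟩ := conj_surjective (includeLeft.comp (Phi D)) (includeRight.comp (Phi D))
      (extendUnit ω)
    have hB1 : B 1 = 1 := by rw [← conj_apply_one, hB, extendUnit_one]
    obtain ⟨β, hβ⟩ := exists_inclIncl_comp_extendUnit D hB1 ((hiff hB.symm).1 hω)
    exact ⟨β, extendUnit_injective (by rw [extendUnit_connectionOfBeta, hβ, hB])⟩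

end Bicross

theorem sub_eq_neg_sub_iff {G : Type*} [AddCommGroup G] (a b x y : G) :
    a - b = -(x - y) ↔ a + x = b + y := by
  rw [neg_sub, sub_eq_sub_iff_add_eq_add, add_comm y]

namespace Bicross

variable {k M H X : Type*} [Field k] [Ring M] [Ring H] [HopfAlgebra k M] [HopfAlgebra k H]
  [Ring X] [Algebra k X] (D : MatchedPair k M H)

/-- The coaction written in `M ⊗ H`, as `h ↦ h⁽²⁾ ⊗ h⁽¹⁾`. -/
def coactSwap : H →ₗ[k] M ⊗[k] H := (TensorProduct.comm k H M).toLinearMap ∘ₗ D.coact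

theorem betaCompatible_iff (β : kerEps k H →ₗ[k] Omega k M) : BetaCompatible D β ↔
    conv ((includeLeft : M ⊗[k] M →ₐ[k] (M ⊗[k] M) ⊗[k] H).toLinearMap ∘ₗ extendUnit β)
        ((inr k M).rTensor H ∘ₗ coactSwap D) =
      conv ((inl k M).rTensor H ∘ₗ coactSwap D)
        ((includeLeft : M ⊗[k] M →ₐ[k] (M ⊗[k] M) ⊗[k] H).toLinearMap ∘ₗ extendUnit β) := by
  have hdU : (dU k M).rTensor H ∘ₗ coactSwap D =
      (inr k M).rTensor H ∘ₗ coactSwap D - (inl k M).rTensor H ∘ₗ coactSwap D := by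
    rw [dU, LinearMap.rTensor_sub, LinearMap.sub_comp]
  rw [extendUnit, LinearMap.comp_add, algHom_comp_convUnit, add_conv, conv_add, convUnit_conv,
    conv_convUnit]
  refine Iff.trans ?_ (sub_eq_neg_sub_iff (G := H →ₗ[k] (M ⊗[k] M) ⊗[k] H) _ _ _ _)
  rw [← hdU]
  rfl

theorem deltaL_comp_inclIncl : deltaL k (Bicross D) ∘ₗ (inclIncl D).toLinearMap =
    (Algebra.TensorProduct.map (incl D) (inclIncl D)).toLinearMap ∘ₗ deltaL k M := by
  have hcomul {j : M →ₐ[k] M ⊗[k] M} {j' : Bicross D →ₐ[k] Bicross D ⊗[k] Bicross D}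
      (hj : j'.comp (incl D) = (inclIncl D).comp j) (m : M) :
      pushComul j' (incl D m) =
        Algebra.TensorProduct.map (incl D) (inclIncl D) (pushComul j m) := by
    rw [pushComul, AlgHom.comp_apply, Bialgebra.comulAlgHom_apply, comul_def,
      AlgHom.toLinearMap_apply, comulHom_incl]
    simp only [pushComul, AlgHom.comp_apply, Bialgebra.comulAlgHom_apply]
    induction Coalgebra.comul (R := k) m with
    | zero => simp
    | add x y hx hy => simp only [map_add, hx, hy]
    | tmul a b => simpa using congrArg (incl D a ⊗ₜ[k] ·) (DFunLike.congr_fun hj b)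
  refine TensorProduct.ext' fun a b => ?_
  have hl : (includeLeft : Bicross D →ₐ[k] Bicross D ⊗[k] Bicross D).comp (incl D) =
      (inclIncl D).comp includeLeft := by
    ext m
    simp [inclIncl]
  have hr : (includeRight : Bicross D →ₐ[k] Bicross D ⊗[k] Bicross D).comp (incl D) =
      (inclIncl D).comp includeRight := by
    ext m
    simp [inclIncl]
  change deltaL k (Bicross D) (incl D a ⊗ₜ incl D b) = Algebra.TensorProduct.map _ _ _
  rw [deltaL_tmul, deltaL_tmul, map_mul, hcomul hl, hcomul hr]

/-- `h ↦ Φ(h⁽¹⁾) ⊗ j(h⁽²⁾)`, the factor by which `Φ` fails to be a map of coalgebras: it multiplies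
`1 ⊗ Φ(h)` in the coproduct of `Φ(h)`. -/
def coactPhi (j : M →ₐ[k] X) : H →ₗ[k] Bicross D ⊗[k] X :=
  (Algebra.TensorProduct.map (Phi D) j).toLinearMap ∘ₗ D.coact

theorem pushComul_comp_Phi (j : Bicross D →ₐ[k] X) :
    ((pushComul j).comp (Phi D)).toLinearMap =
      conv (coactPhi D (j.comp (incl D)))
        ((includeRight : X →ₐ[k] Bicross D ⊗[k] X).comp (j.comp (Phi D))).toLinearMap := by
  let J : Bicross D ⊗[k] Bicross D →ₐ[k] Bicross D ⊗[k] X :=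
    Algebra.TensorProduct.map (.id k (Bicross D)) j
  have hcomul : ((pushComul j).comp (Phi D)).toLinearMap =
      J.toLinearMap ∘ₗ (comulPhi D).toLinearMap :=
    LinearMap.ext fun h => congrArg J (comulHom_Phi D h)
  have hcoact : J.comp (PhiIncl D) = Algebra.TensorProduct.map (Phi D) (j.comp (incl D)) :=
    (Algebra.TensorProduct.map_comp ..).symm
  have hone : J.comp (oneP D) = includeRight.comp (j.comp (Phi D)) := by
    ext h
    simp [J, oneP]
  rw [hcomul, comulPhi_toLinearMap, algHom_comp_conv, coactPhi, ← hcoact, ← hone]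
  rfl

theorem comp_coactPhi {Y : Type*} [Ring Y] [Algebra k Y] (φ : X →ₐ[k] Y) (j : M →ₐ[k] X) :
    (Algebra.TensorProduct.map (.id k (Bicross D)) φ).toLinearMap ∘ₗ coactPhi D j =
      coactPhi D (φ.comp j) := by
  rw [coactPhi, ← LinearMap.comp_assoc, ← AlgHom.comp_toLinearMap,
    ← Algebra.TensorProduct.map_comp, AlgHom.id_comp]
  rfl

/-- The map `x ⊗ h ↦ Φ(h) ⊗ x`, which moves the condition on `β`, an identity in `(M ⊗ M) ⊗ H`,
into the tensor product where left-invariance over `M ▶◁ H` is expressed. -/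
def swapPhi (X : Type*) [Ring X] [Algebra k X] : X ⊗[k] H →ₐ[k] Bicross D ⊗[k] X :=
  (Algebra.TensorProduct.map (Phi D) (.id k X)).comp (Algebra.TensorProduct.comm k X H).toAlgHom

theorem swapPhi_tmul (x : X) (h : H) : swapPhi D X (x ⊗ₜ h) = Phi D h ⊗ₜ x := by
  simp [swapPhi]

theorem swapPhi_injective : Function.Injective (swapPhi D X) := by
  refine Function.LeftInverse.injective
    (g := (TensorProduct.comm k H X) ∘ (projHom D).toLinearMap.rTensor X) fun x => ?_
  simp only [Function.comp_apply]
  induction x with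
  | zero => simp
  | add x y hx hy => simp only [map_add, hx, hy]
  | tmul x h => simp [swapPhi_tmul, projHom_Phi]

theorem swapPhi_comp_coactSwap (j : M →ₐ[k] X) :
    (swapPhi D X).toLinearMap ∘ₗ j.toLinearMap.rTensor H ∘ₗ coactSwap D = coactPhi D j := by
  ext h
  simp only [LinearMap.comp_apply, coactSwap, coactPhi]
  induction D.coact h with
  | zero => simp
  | add x y hx hy => simp only [map_add, hx, hy]
  | tmul g n => simp [swapPhi_tmul]

theorem betaCompatible_iff_conv_coactPhi (β : kerEps k H →ₗ[k] Omega k M) :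
    BetaCompatible D β ↔
      conv ((includeRight : M ⊗[k] M →ₐ[k] Bicross D ⊗[k] (M ⊗[k] M)).toLinearMap ∘ₗ
          extendUnit β) (coactPhi D includeRight) =
        conv (coactPhi D includeLeft)
          ((includeRight : M ⊗[k] M →ₐ[k] Bicross D ⊗[k] (M ⊗[k] M)).toLinearMap ∘ₗ
            extendUnit β) := by
  have hright : (includeRight : M ⊗[k] M →ₐ[k] Bicross D ⊗[k] (M ⊗[k] M)) =
      (swapPhi D (M ⊗[k] M)).comp includeLeft := by
    ext x <;> simp [swapPhi_tmul]
  rw [betaCompatible_iff, hright, ← swapPhi_comp_coactSwap, ← swapPhi_comp_coactSwap,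
    AlgHom.comp_toLinearMap, LinearMap.comp_assoc, ← algHom_comp_conv, ← algHom_comp_conv]
  exact (LinearMap.cancel_left (f := (swapPhi D (M ⊗[k] M)).toLinearMap)
    (swapPhi_injective D)).symm

theorem retr_incl_mul (m : M) (u : Bicross D) : retr D (incl D m * u) = m * retr D u := by
  induction u using induction with
  | zero => simp
  | add x y hx hy => simp only [mul_add, map_add, hx, hy]
  | tmul n h =>
    rw [← incl_mul_Phi, ← mul_assoc, ← map_mul, incl_mul_Phi, incl_mul_Phi, retr_tm, retr_tm,
      mul_smul_comm]

theorem rTensor_retr_comp_coactPhi (j : M →ₐ[k] X) :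
    (retr D).rTensor X ∘ₗ coactPhi D j = convUnit k H (M ⊗[k] X) := by
  ext h
  have hcounit := congrArg (fun m => (1 : M) ⊗ₜ[k] j m) (D.counit_coact h)
  refine Eq.trans ?_ (hcounit.trans ?_)
  · rw [LinearMap.comp_apply, coactPhi, LinearMap.comp_apply]
    induction D.coact h with
    | zero => simp
    | add x y hx hy => simp only [map_add, TensorProduct.tmul_add, hx, hy]
    | tmul g n => simp [Phi_apply, retr_tm, TensorProduct.smul_tmul]
  · rw [convUnit_apply, AlgHom.commutes]
    exact (includeRight : X →ₐ[k] M ⊗[k] X).commutes _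

theorem rTensor_retr_comp_conv_coactPhi (f : H →ₗ[k] M ⊗[k] X) (j : M →ₐ[k] X) :
    (retr D).rTensor X ∘ₗ
      conv ((Algebra.TensorProduct.map (incl D) (.id k X)).toLinearMap ∘ₗ f) (coactPhi D j) =
        f := by
  have hmul (y : M ⊗[k] X) (z : Bicross D ⊗[k] X) :
      (retr D).rTensor X (Algebra.TensorProduct.map (incl D) (.id k X) y * z) =
        y * (retr D).rTensor X z := by
    induction y with
    | zero => simp
    | add x y hx hy => simp only [map_add, add_mul, hx, hy]
    | tmul a b =>
      induction z with
      | zero => simp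
      | add x y hx hy => simp only [map_add, mul_add, hx, hy]
      | tmul c d => simp [retr_incl_mul]
  rw [comp_conv_eq_conv (f' := f) (g' := (retr D).rTensor X ∘ₗ coactPhi D j)
    fun c d => hmul _ _, rTensor_retr_comp_coactPhi, conv_convUnit]

theorem rTensor_retr_comp_conv_includeRight (g : H →ₗ[k] X) (j : M →ₐ[k] X) :
    (retr D).rTensor X ∘ₗ conv (coactPhi D j)
        ((includeRight : X →ₐ[k] Bicross D ⊗[k] X).toLinearMap ∘ₗ g) =
      (includeRight : X →ₐ[k] M ⊗[k] X).toLinearMap ∘ₗ g := by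
  have hmul (z : Bicross D ⊗[k] X) (x : X) : (retr D).rTensor X (z * includeRight x) =
      (retr D).rTensor X z * includeRight x := by
    induction z with
    | zero => simp
    | add x y hx hy => simp only [map_add, add_mul, hx, hy]
    | tmul c d => simp
  rw [comp_conv_eq_conv (f' := (retr D).rTensor X ∘ₗ coactPhi D j)
    (g' := (includeRight : X →ₐ[k] M ⊗[k] X).toLinearMap ∘ₗ g)
    fun c d => hmul _ _, rTensor_retr_comp_coactPhi, convUnit_conv]

theorem isLeftInvariant_connectionOfBeta_iff_conv (β : kerEps k H →ₗ[k] Omega k M) :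
    IsLeftInvariant (connectionOfBeta D β) ↔
      conv ((Algebra.TensorProduct.map (incl D) (.id k (M ⊗[k] M))).toLinearMap ∘ₗ
          deltaL k M ∘ₗ extendUnit β) (coactPhi D includeRight) =
        conv (coactPhi D includeLeft)
          ((includeRight : M ⊗[k] M →ₐ[k] Bicross D ⊗[k] (M ⊗[k] M)).toLinearMap ∘ₗ
            extendUnit β) := by
  let J : Bicross D ⊗[k] (M ⊗[k] M) →ₐ[k] Bicross D ⊗[k] (Bicross D ⊗[k] Bicross D) :=
    Algebra.TensorProduct.map (.id k (Bicross D)) (inclIncl D)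
  have hJ : Function.Injective J.toLinearMap :=
    Module.Flat.lTensor_preserves_injective_linearMap (M := Bicross D)
      (inclIncl D).toLinearMap (inclIncl_injective D)
  have hdelta : deltaL k (Bicross D) ∘ₗ (inclIncl D).toLinearMap =
      J.toLinearMap ∘ₗ (Algebra.TensorProduct.map (incl D) (.id k (M ⊗[k] M))).toLinearMap ∘ₗ
        deltaL k M := by
    rw [deltaL_comp_inclIncl, ← LinearMap.comp_assoc, ← AlgHom.comp_toLinearMap,
      ← Algebra.TensorProduct.map_comp]
    rfl
  have hright : (includeRight : Bicross D ⊗[k] Bicross D →ₐ[k] _).toLinearMap ∘ₗ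
      (inclIncl D).toLinearMap =
        J.toLinearMap ∘ₗ (includeRight : M ⊗[k] M →ₐ[k] _).toLinearMap := by
    ext x
    simp [J]
  have hl : coactPhi D (includeLeft.comp (incl D)) = J.toLinearMap ∘ₗ coactPhi D includeLeft := by
    rw [comp_coactPhi]
    congr 1
  have hr : coactPhi D (includeRight.comp (incl D)) =
      J.toLinearMap ∘ₗ coactPhi D includeRight := by
    rw [comp_coactPhi]
    congr 1
  rw [isLeftInvariant_iff, extendUnit_connectionOfBeta,
    comp_conj_includeLeft_includeRight deltaL_tmul, algHom_comp_conj,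
    conj_eq_conj_iff (pushComul_comp_Phi D _) (pushComul_comp_Phi D _), hl, hr,
    ← LinearMap.comp_assoc, ← LinearMap.comp_assoc, hdelta, hright, LinearMap.comp_assoc,
    LinearMap.comp_assoc, LinearMap.comp_assoc, ← algHom_comp_conv, ← algHom_comp_conv]
  exact LinearMap.cancel_left hJ

theorem isLeftInvariant_connectionOfBeta_iff (β : kerEps k H →ₗ[k] Omega k M) :
    IsLeftInvariant (connectionOfBeta D β) ↔ IsLeftInvariant β ∧ BetaCompatible D β := by
  rw [isLeftInvariant_connectionOfBeta_iff_conv, betaCompatible_iff_conv_coactPhi,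
    isLeftInvariant_iff]
  have hincl : (Algebra.TensorProduct.map (incl D) (.id k (M ⊗[k] M))).toLinearMap ∘ₗ
      (includeRight : M ⊗[k] M →ₐ[k] M ⊗[k] (M ⊗[k] M)).toLinearMap =
        (includeRight : M ⊗[k] M →ₐ[k] Bicross D ⊗[k] (M ⊗[k] M)).toLinearMap := by
    ext x
    simp
  refine ⟨fun h => ?_, fun ⟨hinv, hcomp⟩ => ?_⟩
  · have hinv := congrArg ((retr D).rTensor (M ⊗[k] M) ∘ₗ ·) h
    simp only [rTensor_retr_comp_conv_coactPhi, rTensor_retr_comp_conv_includeRight] at hinv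
    rw [hinv, ← LinearMap.comp_assoc, hincl] at h
    exact ⟨hinv, h⟩
  · rw [hinv, ← LinearMap.comp_assoc, hincl, hcomp]

theorem bijOn_connectionOfBeta :
    Set.BijOn (connectionOfBeta D) (admissibleBetas D) (strongInvariantConnections D) := by
  have hstrong (β : kerEps k H →ₗ[k] Omega k M) :
      IsConnection (deltaR D) (connectionOfBeta D β) ∧
        IsStrong (deltaR D) (connectionOfBeta D β) :=
    (range_connectionOfBeta D).subset ⟨β, rfl⟩
  refine ⟨fun β hβ => ⟨(hstrong β).1, (hstrong β).2,
    (isLeftInvariant_connectionOfBeta_iff D β).2 hβ⟩, (connectionOfBeta_injective D).injOn, ?_⟩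
  rintro ω ⟨hconn, hs, hinv⟩
  obtain ⟨β, rfl⟩ := (range_connectionOfBeta D).superset ⟨hconn, hs⟩
  exact ⟨β, (isLeftInvariant_connectionOfBeta_iff D β).1 hinv, rfl⟩

end Bicross

section Translation

variable {k A : Type*} [Field k] [Ring A] [HopfAlgebra k A]

theorem leftInv_comp_mulLeft (a : A) : leftInv k A ∘ₗ LinearMap.mulLeft k a =
    conv (inl k A ∘ₗ HopfAlgebra.antipode k)
      (LinearMap.mulLeft k (leftInv k A a) ∘ₗ inr k A) := by
  ext b
  simp only [LinearMap.comp_apply, LinearMap.mulLeft_apply, leftInv, conv_apply,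
    Bialgebra.comul_mul]
  induction Coalgebra.comul (R := k) b with
  | zero => simp
  | add x y hx hy => simp only [map_add, mul_add, hx, hy]
  | tmul x y =>
    simp only [TensorProduct.map_tmul, LinearMap.mul'_apply, LinearMap.comp_apply,
      LinearMap.mulLeft_apply]
    induction Coalgebra.comul (R := k) a with
    | zero => simp
    | add x y hx hy => simp only [map_add, add_mul, mul_add, hx, hy]
    | tmul z w => simp [inl_apply, inr_apply, HopfAlgebra.antipode_mul_antidistrib]

theorem conv_inl_leftInv_comp_mulLeft (a : A) :
    conv (inl k A) (leftInv k A ∘ₗ LinearMap.mulLeft k a) =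
      LinearMap.mulLeft k (leftInv k A a) ∘ₗ inr k A := by
  have hinv : conv (inl k A) (inl k A ∘ₗ HopfAlgebra.antipode k) = convUnit k A (A ⊗[k] A) :=
    conv_antipode includeLeft
  rw [leftInv_comp_mulLeft, ← conv_assoc, hinv, convUnit_conv]

end Translation

namespace Bicross

variable {k M H : Type*} [Field k] [Ring M] [Ring H] [HopfAlgebra k M] [HopfAlgebra k H]
  (D : MatchedPair k M H)

/-- `m ⊗ g ↦ g⁽²⁾ S(m₁) ⊗ m₂ ⊗ g⁽¹⁾`, which carries the condition on `γ` to the condition on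
`β`. -/
def coactLeftInv : M ⊗[k] H →ₗ[k] (M ⊗[k] M) ⊗[k] H :=
  LinearMap.mul' k _ ∘ₗ TensorProduct.map ((inl k M).rTensor H ∘ₗ coactSwap D)
    ((includeLeft : M ⊗[k] M →ₐ[k] (M ⊗[k] M) ⊗[k] H).toLinearMap ∘ₗ leftInv k M) ∘ₗ
      (TensorProduct.comm k M H).toLinearMap

theorem coactLeftInv_tmul (m : M) (g : H) : coactLeftInv D (m ⊗ₜ g) =
    (inl k M).rTensor H (coactSwap D g) * (leftInv k M m ⊗ₜ 1) := by
  simp [coactLeftInv]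

theorem coactLeftInv_mul_coactSwap (m : M) (g : H) :
    coactLeftInv D ((m ⊗ₜ 1) * coactSwap D g) =
      (leftInv k M m ⊗ₜ 1) * (inr k M).rTensor H (coactSwap D g) := by
  let κ : M ⊗[k] M →ₗ[k] M ⊗[k] M := LinearMap.mul' k (M ⊗[k] M) ∘ₗ
    TensorProduct.map (inl k M) (leftInv k M ∘ₗ LinearMap.mulLeft k m)
  let K : H ⊗[k] (M ⊗[k] M) →ₗ[k] (M ⊗[k] M) ⊗[k] H :=
    (TensorProduct.comm k _ _).toLinearMap ∘ₗ κ.lTensor H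
  refine Eq.trans ?_ ((congrArg K (D.coact_coassoc g)).trans ?_)
  · simp only [coactSwap, LinearMap.comp_apply]
    induction D.coact g with
    | zero => simp
    | add x y hx hy => simp only [map_add, mul_add, hx, hy]
    | tmul a n =>
      simp only [LinearEquiv.coe_coe, TensorProduct.comm_tmul,
        Algebra.TensorProduct.tmul_mul_tmul, one_mul, coactLeftInv_tmul, coactSwap,
        LinearMap.comp_apply, LinearMap.rTensor_tmul]
      induction D.coact a with
      | zero => simp
      | add x y hx hy => simp only [map_add, add_mul, TensorProduct.add_tmul, hx, hy]
      | tmul b p => simp [K, κ]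
  · simp only [coactSwap, LinearMap.comp_apply]
    induction D.coact g with
    | zero => simp
    | add x y hx hy => simp only [map_add, mul_add, hx, hy]
    | tmul a n =>
      have hκ : κ (Coalgebra.comul n) = leftInv k M m * inr k M n :=
        LinearMap.congr_fun (conv_inl_leftInv_comp_mulLeft (k := k) m) n
      simp [K, hκ]

theorem rTensor_counitLeft_coactLeftInv (x : M ⊗[k] H) :
    (counitLeft k M M).toLinearMap.rTensor H (coactLeftInv D x) = x := by
  let E := Algebra.TensorProduct.map (counitLeft k M M) (.id k H)
  have hcoact (g : H) : E ((inl k M).rTensor H (coactSwap D g)) = 1 ⊗ₜ g := by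
    have hcounit := congrArg (fun a => (1 : M) ⊗ₜ[k] a) (D.coact_counit g)
    refine Eq.trans ?_ hcounit
    simp only [coactSwap, LinearMap.comp_apply]
    induction D.coact g with
    | zero => simp
    | add x y hx hy => simp only [map_add, TensorProduct.tmul_add, hx, hy]
    | tmul a n => simp [E, inl_apply, counitLeft_tmul, TensorProduct.smul_tmul']
  have hleft (m : M) : counitLeft k M M (leftInv k M m) = m :=
    LinearMap.congr_fun counitLeft_comp_leftInv m
  induction x with
  | zero => simp
  | add x y hx hy => simp only [map_add, hx, hy]
  | tmul m g =>
    change E (coactLeftInv D (m ⊗ₜ g)) = m ⊗ₜ g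
    rw [coactLeftInv_tmul, map_mul, hcoact]
    simp [E, hleft]

theorem gammaCompatible_iff (γ : H →ₗ[k] M) : GammaCompatible D γ ↔
    conv ((includeLeft : M ⊗[k] M →ₐ[k] (M ⊗[k] M) ⊗[k] H).toLinearMap ∘ₗ leftInv k M ∘ₗ γ)
        ((inr k M).rTensor H ∘ₗ coactSwap D) =
      conv ((inl k M).rTensor H ∘ₗ coactSwap D)
        ((includeLeft : M ⊗[k] M →ₐ[k] (M ⊗[k] M) ⊗[k] H).toLinearMap ∘ₗ
          leftInv k M ∘ₗ γ) := by
  have hl : coactLeftInv D ∘ₗ conv ((includeLeft : M →ₐ[k] M ⊗[k] H).toLinearMap ∘ₗ γ)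
      (coactSwap D) = conv ((includeLeft : M ⊗[k] M →ₐ[k] (M ⊗[k] M) ⊗[k] H).toLinearMap ∘ₗ
        leftInv k M ∘ₗ γ) ((inr k M).rTensor H ∘ₗ coactSwap D) :=
    comp_conv_eq_conv fun a b => coactLeftInv_mul_coactSwap D (γ a) b
  have hr : (coactLeftInv D ∘ₗ γ.rTensor H ∘ₗ (TensorProduct.comm k H H).toLinearMap) ∘ₗ
      Coalgebra.comul = conv ((inl k M).rTensor H ∘ₗ coactSwap D)
        ((includeLeft : M ⊗[k] M →ₐ[k] (M ⊗[k] M) ⊗[k] H).toLinearMap ∘ₗ leftInv k M ∘ₗ γ) :=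
    comp_comul_eq_conv fun a b => coactLeftInv_tmul D (γ b) a
  rw [← hl, ← hr]
  exact (LinearMap.cancel_left (f := coactLeftInv D)
    (Function.LeftInverse.injective (rTensor_counitLeft_coactLeftInv D))).symm

theorem betaCompatible_betaOfGamma_iff {γ : H →ₗ[k] M} (h1 : γ 1 = 1)
    (hε : ∀ h, Coalgebra.counit (R := k) (γ h) = Coalgebra.counit (R := k) h) :
    BetaCompatible D (betaOfGamma γ) ↔ GammaCompatible D γ := by
  rw [betaCompatible_iff, betaOfGamma, extendUnit_maurerCartan_comp h1 hε, gammaCompatible_iff]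

theorem bijOn_betaOfGamma :
    Set.BijOn betaOfGamma (admissibleGammas D) (admissibleBetas D) := by
  have hbij := bijOn_maurerCartan_comp (k := k) (A := M) (C := H)
  refine ⟨?_, hbij.injOn.mono ?_, ?_⟩
  · rintro γ ⟨h1, hε, hγ⟩
    exact ⟨hbij.mapsTo ⟨h1, hε⟩, (betaCompatible_betaOfGamma_iff D h1 hε).2 hγ⟩
  · exact fun γ hγ => ⟨hγ.1, hγ.2.1⟩
  · rintro β ⟨hinv, hβ⟩
    obtain ⟨γ, ⟨h1, hε⟩, rfl⟩ := hbij.surjOn hinv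
    exact ⟨γ, ⟨h1, hε, (betaCompatible_betaOfGamma_iff D h1 hε).1 hβ⟩, rfl⟩

end Bicross

section Homogeneous

variable {k P H : Type*} [Field k] [Ring P] [HopfAlgebra k P] [Ring H] [HopfAlgebra k H]

theorem chi_pushComul_comp_leftInv (π : P →ₐ[k] H) :
    chi (pushComul π).toLinearMap ∘ₗ leftInv k P =
      (includeRight : H →ₐ[k] P ⊗[k] H).toLinearMap ∘ₗ π.toLinearMap := by
  rw [leftInv_eq_conj, comp_conj _ (map_includeLeft_mul_mul_includeRight chi_tmul),
    comp_convUnit_of_map_tmul chi_tmul, conj_eq_iff, convUnit_conv, pushComul_eq_conv,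
    AlgHom.comp_toLinearMap]

theorem rTensor_counitLeft_deltaR₂_comp_leftInv (π : P →ₐ[k] H) :
    (counitLeft k P P).toLinearMap.rTensor H ∘ₗ deltaR₂ (pushComul π).toLinearMap ∘ₗ
      leftInv k P = π.toLinearMap.lTensor P ∘ₗ Ad k P := by
  let E : (P ⊗[k] P) ⊗[k] H →ₐ[k] P ⊗[k] H :=
    Algebra.TensorProduct.map (counitLeft k P P) (.id k H)
  let l : P →ₐ[k] P ⊗[k] P := includeLeft
  have hl : E.comp (pushCoact (pushComul π) l) = includeRight.comp π := by
    ext u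
    have hcounit := congrArg (fun v => (1 : P) ⊗ₜ[k] π (TensorProduct.lid k P v))
      (Coalgebra.rTensor_counit_comul (R := k) u)
    refine Eq.trans ?_ (hcounit.trans (by simp))
    simp only [pushCoact, pushComul, AlgHom.comp_apply, Bialgebra.comulAlgHom_apply]
    induction Coalgebra.comul (R := k) u with
    | zero => simp
    | add x y hx hy => simp only [map_add, TensorProduct.tmul_add, hx, hy]
    | tmul a b => simp [E, l, counitLeft_tmul, TensorProduct.smul_tmul]
  have hr : E.comp (pushCoact (pushComul π) includeRight) = pushComul π := by
    rw [pushCoact, ← AlgHom.comp_assoc, ← Algebra.TensorProduct.map_comp,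
      counitLeft_comp_includeRight, AlgHom.comp_id, Algebra.TensorProduct.map_id, AlgHom.id_comp]
  have hAd : π.toLinearMap.lTensor P ∘ₗ Ad k P = conj (includeRight.comp π)
      (includeRight.comp π) (includeLeft : P →ₐ[k] P ⊗[k] H).toLinearMap := by
    have hconj := rTensor_comp_Ad (k := k) (A := P) LinearMap.id
    rw [LinearMap.rTensor_id, LinearMap.id_comp, LinearMap.comp_id] at hconj
    rw [hconj]
    refine (algHom_comp_conj (Algebra.TensorProduct.map (.id k P) π) _ _ _).trans ?_
    congr 1
    ext u
    simp
  calc _ = E.toLinearMap ∘ₗ deltaR₂ (pushComul π).toLinearMap ∘ₗ leftInv k P := rfl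
    _ = conj (includeRight.comp π) (pushComul π) (convUnit k P (P ⊗[k] H)) := by
      rw [leftInv_eq_conj, comp_conj _ (map_includeLeft_mul_mul_includeRight deltaR₂_tmul),
        comp_convUnit_of_map_tmul deltaR₂_tmul, algHom_comp_conj, algHom_comp_convUnit, hl, hr]
    _ = _ := by
      rw [hAd, conj_eq_iff, conv_conj, convUnit_conv, pushComul_eq_conv]

theorem exists_isSplitting_eq_canonicalConnection {π : P →ₐ[k] H}
    {ω : kerEps k H →ₗ[k] Omega k P} (hω : IsConnection (pushComul π).toLinearMap ω)
    (hinv : IsLeftInvariant ω) :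
    ∃ i : kerEps k H →ₗ[k] kerEps k P,
      (∀ h, (i h : P) = counitLeft k P P (ω h)) ∧
      IsSplitting π.toLinearMap i ∧ ω = canonicalConnection i := by
  obtain ⟨s, ⟨h1, hε⟩, rfl⟩ := bijOn_maurerCartan_comp.surjOn hinv
  have hs := extendUnit_maurerCartan_comp h1 hε
  rw [isConnection_iff, hs] at hω
  obtain ⟨hchi, hAd⟩ := hω
  refine ⟨LinearMap.codRestrict _ (s ∘ₗ (kerEps k H).subtype) fun h => (hε h).trans h.2,
    fun h => ?_, ⟨fun h => ?_, fun h => ?_⟩, rfl⟩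
  · rw [← extendUnit_coe, hs]
    exact (LinearMap.congr_fun counitLeft_comp_leftInv (s h)).symm
  · rw [← LinearMap.comp_assoc, chi_pushComul_comp_leftInv] at hchi
    have hπ : π (s h) = h := by
      simpa [counitLeft_tmul] using congrArg (counitLeft k P H) (LinearMap.congr_fun hchi h)
    exact hπ
  · calc π.toLinearMap.lTensor P (Ad k P (s h))
        = (counitLeft k P P).toLinearMap.rTensor H
            (deltaR₂ (pushComul π).toLinearMap (leftInv k P (s h))) :=
          (LinearMap.congr_fun (rTensor_counitLeft_deltaR₂_comp_leftInv π) (s h)).symm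
      _ = (counitLeft k P P).toLinearMap.rTensor H ((leftInv k P ∘ₗ s).rTensor H (Ad k H h)) :=
          congrArg _ (LinearMap.congr_fun hAd h)
      _ = s.rTensor H (Ad k H h) := by
          rw [← LinearMap.rTensor_comp_apply, ← LinearMap.comp_assoc, counitLeft_comp_leftInv,
            LinearMap.id_comp]
      _ = (s ∘ₗ (kerEps k H).subtype).rTensor H (AdKer k H h) := (rTensor_AdKer h1 h).symm

end Homogeneous

namespace Bicross

variable {k M H : Type*} [Field k] [Ring M] [Ring H] [HopfAlgebra k M] [HopfAlgebra k H]
  (D : MatchedPair k M H)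

theorem splittingOfGamma_eq_conv (γ : H →ₗ[k] M) :
    splittingOfGamma D γ = conv ((incl D).toLinearMap ∘ₗ γ) (Phi D).toLinearMap :=
  comp_comul_eq_conv (T := (of D).toLinearMap ∘ₗ γ.rTensor H) fun a b =>
    (incl_mul_Phi D (γ a) b).symm

theorem counitLeft_comp_extendUnit_connectionOfBeta {γ : H →ₗ[k] M} (h1 : γ 1 = 1)
    (hε : ∀ h, Coalgebra.counit (R := k) (γ h) = Coalgebra.counit (R := k) h) :
    (counitLeft k (Bicross D) (Bicross D)).toLinearMap ∘ₗ
      extendUnit (connectionOfBeta D (betaOfGamma γ)) = splittingOfGamma D γ := by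
  have hPhi : ((counitLeft k (Bicross D) (Bicross D)).comp
      (includeLeft.comp (Phi D))).toLinearMap = convUnit k H (Bicross D) := by
    ext h
    have hcounit : Coalgebra.counit (R := k) (Phi D h) = Coalgebra.counit h := counitHom_Phi D h
    simp [counitLeft_tmul, hcounit, convUnit_apply, Algebra.algebraMap_eq_smul_one]
  have hincl : (counitLeft k (Bicross D) (Bicross D)).comp (inclIncl D) =
      (incl D).comp (counitLeft k M M) := by
    ext m
    · have hcounit : Coalgebra.counit (R := k) (incl D m) = Coalgebra.counit m :=
        counitHom_incl D m
      simp [inclIncl, counitLeft_tmul, hcounit]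
    · simp [inclIncl, counitLeft_tmul]
  rw [extendUnit_connectionOfBeta, betaOfGamma, extendUnit_maurerCartan_comp h1 hε,
    algHom_comp_conj, ← LinearMap.comp_assoc, ← AlgHom.comp_toLinearMap, hincl,
    splittingOfGamma_eq_conv, conj_eq_iff, hPhi, convUnit_conv, AlgHom.comp_toLinearMap,
    LinearMap.comp_assoc, ← LinearMap.comp_assoc γ, counitLeft_comp_leftInv, LinearMap.id_comp,
    ← AlgHom.comp_assoc, counitLeft_comp_includeRight, AlgHom.id_comp]

theorem exists_splittingOfGamma {γ : H →ₗ[k] M} (hγ : γ ∈ admissibleGammas D) :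
    ∃ i : kerEps k H →ₗ[k] kerEps k (Bicross D),
      (∀ h : kerEps k H, (i h : Bicross D) = splittingOfGamma D γ h) ∧
      IsSplitting (proj D) i ∧
      connectionOfBeta D (betaOfGamma γ) = canonicalConnection i := by
  obtain ⟨hconn, _, hinv⟩ :=
    (bijOn_connectionOfBeta D).mapsTo ((bijOn_betaOfGamma D).mapsTo hγ)
  rw [deltaR_eq] at hconn
  obtain ⟨i, hi, hsplit⟩ :=
    exists_isSplitting_eq_canonicalConnection (π := projHom D) hconn hinv
  refine ⟨i, fun h => ?_, proj_eq D ▸ hsplit⟩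
  rw [hi, ← extendUnit_coe, ← counitLeft_comp_extendUnit_connectionOfBeta D hγ.1 hγ.2.1]
  rfl

end Bicross

end QPB

end

theorem proposition6p1 {k M H : Type*} [Field k] [Ring M] [Ring H] [HopfAlgebra k M]
    [HopfAlgebra k H] (D : QPB.MatchedPair k M H) :
    Set.BijOn (QPB.Bicross.connectionOfBeta D)
      (QPB.Bicross.admissibleBetas D) (QPB.Bicross.strongInvariantConnections D) ∧
    Set.BijOn QPB.Bicross.betaOfGamma
      (QPB.Bicross.admissibleGammas D) (QPB.Bicross.admissibleBetas D) ∧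
    ∀ γ ∈ QPB.Bicross.admissibleGammas D,
      ∃ i : QPB.kerEps k H →ₗ[k] QPB.kerEps k (QPB.Bicross D),
        (∀ h : QPB.kerEps k H, (i h : QPB.Bicross D) = QPB.Bicross.splittingOfGamma D γ h) ∧
        QPB.IsSplitting (QPB.Bicross.proj D) i ∧
        QPB.Bicross.connectionOfBeta D (QPB.Bicross.betaOfGamma γ) =
          QPB.canonicalConnection i := by
  exact ⟨QPB.Bicross.bijOn_connectionOfBeta D, QPB.Bicross.bijOn_betaOfGamma D,
    fun _ hγ => QPB.Bicross.exists_splittingOfGamma D hγ⟩
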